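/- Let $(M,g)$ be a smooth Lorentzian manifold of dimension $d\ge 4$, with signature $(-,+,\dots,+)$ and Levi-Civita connection $\nabla$, whose Ricci tensor has the form $$R_{ab}=\lambda\, g_{ab}+\eta\, k_a k_b ,$$ where $\lambda$ is a real constant, $\eta$ is a smooth function and $k$ is a smooth nowhere vanishing null vector field. Let $\ell$ be a smooth null vector field. A null frame at a point $p$ is a frame $e_{(0)}=\ell,\ e_{(1)}=n,\ e_{(i)}=m_{(i)}$ $(i=2,\dots,d-1)$ of $T_pM$ with $g(\ell,\ell)=g(n,n)=g(\ell,m_{(i)})=g(n,m_{(i)})=0$, $g(\ell,n)=1$, $g(m_{(i)},m_{(j)})=\delta_{ij}$. Put $L_{ab}=\nabla_b\ell_a$, $\kappa_i=L_{ab}m_{(i)}^a\ell^b$ and $\rho_{ij}=L_{ab}m_{(i)}^am_{(j)}^b$ (the optical matrix). The field $\ell$ is geodetic at $p$ if $\kappa_i=0$ for all $i$, and Kundt at $p$ if moreover the expansion $\operatorname{tr}\rho/(d-2)$, the shear (the trace-free symmetric part of $\rho$) and the twist (the skew-symmetric part of $\rho$) vanish. Suppose that the spacetime is of genuine Weyl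 type N with multiple WAND $\ell$: at every point the Weyl tensor is nonzero and, in some null frame with first vector $\ell$, all its components of boost weight greater than $-2$ vanish, where the boost weight of a frame component is the number of its indices $0$ minus the number of its indices $1$. Suppose also that it is twist-free: at every point $\rho_{ij}=\rho_{ji}$ in some null frame with first vector $\ell$. Then, at every point $p$ and for every null frame at $p$ with first vector $\ell$, the field $\ell$ is geodetic, the optical matrix is normal, $\rho^{T}\rho=\rho\rho^{T}$, and there are a spin $m_{(i)}\mapsto X_{ij}m_{(j)}$, $X\in SO(d-2)$, and real numbers $s,b$ such that the optical matrix in the spun frame is $$\rho=s\,\operatorname{diag}(1,b,0,\dots,0).$$ Here $b\ne 1$ if $\eta(p)\neq 0$, and $b=1$ if $\eta(p)=0$; in particular $b\neq1$ everywhere if $\eta$ has no zeros, while $b=1$ is the Einstein case. Moreover $s=0$ if and only if $\ell$ is Kundt at $p$, and the optical constraint $\rho_{ik}\rho_{jk}=c\,\rho_{(ij)}$ for some $c\in\mathbb R$ holds if and only if $s=0$ or $b\in\{0,1\}$. Thus, where $\eta\ne0$, the optical constraint is violated exactly when $\rho$ has rank $2$. -/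

import Mathlib

open scoped Manifold ContDiff

noncomputable section

namespace Spacetime

/-! ### Curvature of a metric given by its components in a coordinate domain -/

section Coordinates

variable {d : ℕ}

/-- The partial derivative `∂_a f`. -/
def partialDeriv (a : Fin d) (f : EuclideanSpace ℝ (Fin d) → ℝ)
    (y : EuclideanSpace ℝ (Fin d)) : ℝ :=
  fderiv ℝ f y (EuclideanSpace.single a 1)

/-- Christoffel symbols `Γ^a_{bc} = ½ g^{ae} (∂_b g_{ec} + ∂_c g_{eb} - ∂_e g_{bc})`. -/
def christoffel (G : EuclideanSpace ℝ (Fin d) → Matrix (Fin d) (Fin d) ℝ) (a b c : Fin d)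
    (y : EuclideanSpace ℝ (Fin d)) : ℝ :=
  (1 / 2 : ℝ) * ∑ e, (G y)⁻¹ a e *
    (partialDeriv b (fun z => G z e c) y + partialDeriv c (fun z => G z e b) y
      - partialDeriv e (fun z => G z b c) y)

/-- `R^a_{bcf} = ∂_c Γ^a_{fb} - ∂_f Γ^a_{cb} + Γ^a_{ce} Γ^e_{fb} - Γ^a_{fe} Γ^e_{cb}`. -/
def riemannUp (G : EuclideanSpace ℝ (Fin d) → Matrix (Fin d) (Fin d) ℝ) (a b c f : Fin d)
    (y : EuclideanSpace ℝ (Fin d)) : ℝ :=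
  partialDeriv c (christoffel G a f b) y - partialDeriv f (christoffel G a c b) y
    + ∑ e, (christoffel G a c e y * christoffel G e f b y
      - christoffel G a f e y * christoffel G e c b y)

/-- `R_{abcf} = g_{ae} R^e_{bcf}`. -/
def riemannDown (G : EuclideanSpace ℝ (Fin d) → Matrix (Fin d) (Fin d) ℝ) (a b c f : Fin d)
    (y : EuclideanSpace ℝ (Fin d)) : ℝ :=
  ∑ e, G y a e * riemannUp G e b c f y

/-- `R_{bf} = R^a_{baf}`. -/
def ricciComp (G : EuclideanSpace ℝ (Fin d) → Matrix (Fin d) (Fin d) ℝ) (b f : Fin d)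
    (y : EuclideanSpace ℝ (Fin d)) : ℝ :=
  ∑ a, riemannUp G a b a f y

/-- The scalar curvature `g^{ab} R_{ab}`. -/
def scalarCurv (G : EuclideanSpace ℝ (Fin d) → Matrix (Fin d) (Fin d) ℝ)
    (y : EuclideanSpace ℝ (Fin d)) : ℝ :=
  ∑ a, ∑ b, (G y)⁻¹ a b * ricciComp G a b y

/-- The Weyl tensor
`C_{abcf} = R_{abcf} - (g_{ac} R_{fb} - g_{af} R_{cb} - g_{bc} R_{fa} + g_{bf} R_{ca}) / (d-2)
  + R (g_{ac} g_{fb} - g_{af} g_{cb}) / ((d-1)(d-2))`. -/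
def weylComp (G : EuclideanSpace ℝ (Fin d) → Matrix (Fin d) (Fin d) ℝ) (a b c f : Fin d)
    (y : EuclideanSpace ℝ (Fin d)) : ℝ :=
  riemannDown G a b c f y
    - (G y a c * ricciComp G f b y - G y a f * ricciComp G c b y
        - G y b c * ricciComp G f a y + G y b f * ricciComp G c a y) / ((d : ℝ) - 2)
    + scalarCurv G y * (G y a c * G y f b - G y a f * G y c b)
        / (((d : ℝ) - 1) * ((d : ℝ) - 2))

/-- `(∇_b V)^a = ∂_b V^a + Γ^a_{bc} V^c`. -/
def covDerivComp (G : EuclideanSpace ℝ (Fin d) → Matrix (Fin d) (Fin d) ℝ)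
    (V : EuclideanSpace ℝ (Fin d) → Fin d → ℝ) (a b : Fin d)
    (y : EuclideanSpace ℝ (Fin d)) : ℝ :=
  partialDeriv b (fun z => V z a) y + ∑ c, christoffel G a b c y * V y c

end Coordinates

/-! ### Lorentzian manifolds -/

/-- A smooth Lorentzian metric, of signature `(-, +, …, +)`, on a `d`-dimensional manifold. -/
structure LorentzianMetric (d : ℕ) (M : Type*) [TopologicalSpace M]
    [ChartedSpace (EuclideanSpace ℝ (Fin d)) M] [IsManifold (𝓡 d) ∞ M] where
  /-- The scalar product on each tangent space. -/
  inner (p : M) : TangentSpace (𝓡 d) p →L[ℝ] TangentSpace (𝓡 d) p →L[ℝ] ℝ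
  symm (p : M) (u v : TangentSpace (𝓡 d) p) : inner p u v = inner p v u
  /-- Existence of an orthonormal basis; its linear independence is automatic. -/
  lorentzian (p : M) : ∃ v : Fin d → TangentSpace (𝓡 d) p, ∀ i j,
    inner p (v i) (v j) = if i = j then (if (i : ℕ) = 0 then -1 else 1) else 0
  contMDiff : ContMDiff (𝓡 d)
    ((𝓡 d).prod 𝓘(ℝ, EuclideanSpace ℝ (Fin d) →L[ℝ] EuclideanSpace ℝ (Fin d) →L[ℝ] ℝ)) ∞
    (fun p => Bundle.TotalSpace.mk'
      (EuclideanSpace ℝ (Fin d) →L[ℝ] EuclideanSpace ℝ (Fin d) →L[ℝ] ℝ) p (inner p))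

section Manifold

variable {d : ℕ} {M : Type*} [TopologicalSpace M] [ChartedSpace (EuclideanSpace ℝ (Fin d)) M]

/-- A vector field on the manifold (no regularity included). -/
abbrev VectorField (d : ℕ) (M : Type*) [TopologicalSpace M]
    [ChartedSpace (EuclideanSpace ℝ (Fin d)) M] : Type _ :=
  (p : M) → TangentSpace (𝓡 d) p

/-- Smoothness of a vector field, as a section of the tangent bundle. -/
def IsSmoothVectorField [IsManifold (𝓡 d) ∞ M] (X : VectorField d M) : Prop :=
  ContMDiff (𝓡 d) (𝓡 d).tangent ∞ (fun p => (⟨p, X p⟩ : TangentBundle (𝓡 d) M))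

/-- The component `u^a` of a tangent vector at `p` in the chart `e`. -/
def vecComp (e : OpenPartialHomeomorph M (EuclideanSpace ℝ (Fin d))) (p : M)
    (u : TangentSpace (𝓡 d) p) (a : Fin d) : ℝ :=
  (show EuclideanSpace ℝ (Fin d) from mfderiv (𝓡 d) (𝓡 d) e p u) a

/-- The coordinate vector `∂_a` of the chart `e` at the point with coordinates `y`. -/
def coordVec (e : OpenPartialHomeomorph M (EuclideanSpace ℝ (Fin d)))
    (y : EuclideanSpace ℝ (Fin d)) (a : Fin d) : TangentSpace (𝓡 d) (e.symm y) :=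
  mfderiv (𝓡 d) (𝓡 d) e.symm y
    (show TangentSpace (𝓡 d) y from (EuclideanSpace.single a 1 : EuclideanSpace ℝ (Fin d)))

/-- The components of a vector field in the chart `e`, as functions of the coordinates. -/
def fieldComp (e : OpenPartialHomeomorph M (EuclideanSpace ℝ (Fin d))) (X : VectorField d M)
    (y : EuclideanSpace ℝ (Fin d)) (a : Fin d) : ℝ :=
  vecComp e (e.symm y) (X (e.symm y)) a

variable [IsManifold (𝓡 d) ∞ M]

/-- The components `g_{ab}` of the metric in the chart `e`, as functions of the coordinates. -/
def metricComp (g : LorentzianMetric d M)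
    (e : OpenPartialHomeomorph M (EuclideanSpace ℝ (Fin d))) (y : EuclideanSpace ℝ (Fin d)) :
    Matrix (Fin d) (Fin d) ℝ :=
  fun a b => g.inner (e.symm y) (coordVec e y a) (coordVec e y b)

/-- The Ricci tensor at `p`, computed in the chart `e`. -/
def ricci (g : LorentzianMetric d M) (e : OpenPartialHomeomorph M (EuclideanSpace ℝ (Fin d)))
    (p : M) (u v : TangentSpace (𝓡 d) p) : ℝ :=
  ∑ a, ∑ b, ricciComp (metricComp g e) a b (e p) * vecComp e p u a * vecComp e p v b

/-- The Weyl tensor at `p`, computed in the chart `e`. -/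
def weyl (g : LorentzianMetric d M) (e : OpenPartialHomeomorph M (EuclideanSpace ℝ (Fin d)))
    (p : M) (u v w x : TangentSpace (𝓡 d) p) : ℝ :=
  ∑ a, ∑ b, ∑ c, ∑ f, weylComp (metricComp g e) a b c f (e p)
    * vecComp e p u a * vecComp e p v b * vecComp e p w c * vecComp e p x f

/-- `L(u, v) = L_{ab} u^a v^b` with `L_{ab} = ∇_b ℓ_a`, that is `g(u, ∇_v ℓ)`, at `p`, for the
Levi-Civita connection, computed in the chart `e`. -/
def gradForm (g : LorentzianMetric d M) (e : OpenPartialHomeomorph M (EuclideanSpace ℝ (Fin d)))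
    (l : VectorField d M) (p : M) (u v : TangentSpace (𝓡 d) p) : ℝ :=
  ∑ c, ∑ a, ∑ b, metricComp g e (e p) c a * vecComp e p u c
    * covDerivComp (metricComp g e) (fieldComp e l) a b (e p) * vecComp e p v b

/-! ### Null frames -/

/-- The vectors `ℓ, n, m_(i)` of a frame of the tangent space at `p`; the `d - 2` spacelike
vectors are numbered from `0`. -/
structure Frame (d : ℕ) {M : Type*} [TopologicalSpace M]
    [ChartedSpace (EuclideanSpace ℝ (Fin d)) M] (p : M) where
  l : TangentSpace (𝓡 d) p
  n : TangentSpace (𝓡 d) p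
  m : Fin (d - 2) → TangentSpace (𝓡 d) p

/-- The frame is a null frame with first vector `l p`. -/
structure IsNullFrame (g : LorentzianMetric d M) (l : VectorField d M) (p : M)
    (F : Frame d p) : Prop where
  l_eq : F.l = l p
  l_l : g.inner p F.l F.l = 0
  n_n : g.inner p F.n F.n = 0
  l_m : ∀ i, g.inner p F.l (F.m i) = 0
  n_m : ∀ i, g.inner p F.n (F.m i) = 0
  l_n : g.inner p F.l F.n = 1
  m_m : ∀ i j, g.inner p (F.m i) (F.m j) = if i = j then 1 else 0

/-- The frame vectors `e_(0) = ℓ`, `e_(1) = n`, `e_(i) = m_(i)` as one family. -/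
def Frame.vec {p : M} (F : Frame d p) : Fin 2 ⊕ Fin (d - 2) → TangentSpace (𝓡 d) p
  | Sum.inl a => if a = 0 then F.l else F.n
  | Sum.inr i => F.m i

/-- The contribution of a frame index to the boost weight: a frame component has boost weight
the number of its indices `0` minus the number of its indices `1`. -/
def boostWeight : Fin 2 ⊕ Fin (d - 2) → ℤ
  | Sum.inl a => if a = 0 then 1 else -1
  | Sum.inr _ => 0

/-- The spin `m_(i) ↦ X_{ij} m_(j)`. -/
def Frame.spin {p : M} (F : Frame d p) (X : Matrix (Fin (d - 2)) (Fin (d - 2)) ℝ) : Frame d p where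
  l := F.l
  n := F.n
  m := fun i => ∑ j, X i j • F.m j

/-- The optical matrix `ρ_{ij} = L_{(i)(j)}`. -/
def opticalMatrix (g : LorentzianMetric d M)
    (e : OpenPartialHomeomorph M (EuclideanSpace ℝ (Fin d))) (l : VectorField d M) (p : M)
    (F : Frame d p) : Matrix (Fin (d - 2)) (Fin (d - 2)) ℝ :=
  fun i j => gradForm g e l p (F.m i) (F.m j)

/-- `ℓ` is geodetic at the point of the frame: `κ_i = L_{(i)(0)} = 0`. -/
def IsGeodetic (g : LorentzianMetric d M)
    (e : OpenPartialHomeomorph M (EuclideanSpace ℝ (Fin d))) (l : VectorField d M) (p : M)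
    (F : Frame d p) : Prop :=
  ∀ i, gradForm g e l p (F.m i) F.l = 0

/-! ### Optical scalars and conditions on the optical matrix -/

/-- The symmetric part `S` of the optical matrix. -/
def symPart {N : ℕ} (ρ : Matrix (Fin N) (Fin N) ℝ) : Matrix (Fin N) (Fin N) ℝ :=
  (1 / 2 : ℝ) • (ρ + ρ.transpose)

/-- The skew-symmetric part `A` of the optical matrix. -/
def skewPart {N : ℕ} (ρ : Matrix (Fin N) (Fin N) ℝ) : Matrix (Fin N) (Fin N) ℝ :=
  (1 / 2 : ℝ) • (ρ - ρ.transpose)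

/-- The expansion `θ = tr ρ / (d - 2)`. -/
def expansion {N : ℕ} (ρ : Matrix (Fin N) (Fin N) ℝ) : ℝ := ρ.trace / N

/-- The square of the shear, `σ_{ij} σ_{ij}` with `σ_{ij} = S_{ij} - θ δ_{ij}`. -/
def shearSq {N : ℕ} (ρ : Matrix (Fin N) (Fin N) ℝ) : ℝ :=
  ∑ i, ∑ j, (symPart ρ i j - if i = j then expansion ρ else 0) ^ 2

/-- The square of the twist, `A_{ij} A_{ij}`. -/
def twistSq {N : ℕ} (ρ : Matrix (Fin N) (Fin N) ℝ) : ℝ :=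
  ∑ i, ∑ j, skewPart ρ i j ^ 2

/-- A real normal matrix. -/
def IsNormalMatrix {N : ℕ} (ρ : Matrix (Fin N) (Fin N) ℝ) : Prop :=
  ρ.transpose * ρ = ρ * ρ.transpose

/-- The optical constraint `ρ_{ik} ρ_{jk} ∝ ρ_{(ij)}`. -/
def OpticalConstraint {N : ℕ} (ρ : Matrix (Fin N) (Fin N) ℝ) : Prop :=
  ∃ c : ℝ, ρ * ρ.transpose = c • symPart ρ

/-- The matrix `s · diag(1, b, 0, …, 0)`. -/
def canonicalForm (N : ℕ) (s b : ℝ) : Matrix (Fin N) (Fin N) ℝ :=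
  s • Matrix.diagonal (fun i : Fin N => if (i : ℕ) = 0 then 1 else if (i : ℕ) = 1 then b else 0)

/-- The Kundt condition on `ℓ` at the point of the frame: geodetic, with vanishing expansion, shear
and twist. -/
def IsKundt (g : LorentzianMetric d M)
    (e : OpenPartialHomeomorph M (EuclideanSpace ℝ (Fin d))) (l : VectorField d M) (p : M)
    (F : Frame d p) : Prop :=
  IsGeodetic g e l p F ∧ expansion (opticalMatrix g e l p F) = 0 ∧
    shearSq (opticalMatrix g e l p F) = 0 ∧ twistSq (opticalMatrix g e l p F) = 0

/-! ### The classes of spacetimes; equations between tensors are required in every chart -/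

/-- The spacetime is of (genuine) Weyl type N with multiple WAND `ℓ`: at every point the Weyl tensor
is nonzero, and in some null frame with first vector `ℓ` its components of boost weight greater than
`-2` vanish. -/
def IsWeylTypeN (g : LorentzianMetric d M) (l : VectorField d M) : Prop :=
  ∀ e ∈ atlas (EuclideanSpace ℝ (Fin d)) M, ∀ p ∈ e.source,
    (∃ u v w x, weyl g e p u v w x ≠ 0) ∧
    ∃ F : Frame d p, IsNullFrame g l p F ∧ ∀ a b c f : Fin 2 ⊕ Fin (d - 2),
      -2 < boostWeight a + boostWeight b + boostWeight c + boostWeight f →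
        weyl g e p (F.vec a) (F.vec b) (F.vec c) (F.vec f) = 0

/-- The Ricci tensor is `lam g_{ab} + η k_a k_b`. -/
def HasRicciForm (g : LorentzianMetric d M) (lam : ℝ) (η : M → ℝ) (k : VectorField d M) : Prop :=
  ∀ e ∈ atlas (EuclideanSpace ℝ (Fin d)) M, ∀ p ∈ e.source, ∀ u v : TangentSpace (𝓡 d) p,
    ricci g e p u v = lam * g.inner p u v + η p * (g.inner p (k p) u * g.inner p (k p) v)

/-- The field `ℓ` is non-twisting: at every point `A_{ij} = 0` in some null frame with first
vector `ℓ`. (For geodetic `ℓ` the condition does not depend on the frame.) -/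
def IsTwistFree (g : LorentzianMetric d M) (l : VectorField d M) : Prop :=
  ∀ e ∈ atlas (EuclideanSpace ℝ (Fin d)) M, ∀ p ∈ e.source,
    ∃ F : Frame d p, IsNullFrame g l p F ∧ skewPart (opticalMatrix g e l p F) = 0

end Manifold

end Spacetime

end

open scoped Manifold ContDiff Topology

set_option maxSynthPendingDepth 3

noncomputable section

namespace Spacetime

/-! ### Metrics and connections on an open subset of a vector space -/

section Local

variable {E : Type*} [NormedAddCommGroup E] [NormedSpace ℝ E]

/-- A smooth symmetric form on an open set together with its torsion-free metric connection,
`∇_u V = ∂_u V + Γ(u, V)`. -/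
structure LocalMetric (E : Type*) [NormedAddCommGroup E] [NormedSpace ℝ E] where
  U : Set E
  isOpen : IsOpen U
  g : E → E →L[ℝ] E →L[ℝ] ℝ
  Γ : E → E →L[ℝ] E →L[ℝ] E
  contDiffOn_g : ContDiffOn ℝ ∞ g U
  contDiffOn_Γ : ContDiffOn ℝ ∞ Γ U
  g_symm : ∀ y u v, g y u v = g y v u
  Γ_symm : ∀ y u v, Γ y u v = Γ y v u
  compat : ∀ y ∈ U, ∀ e a b, fderiv ℝ g y e a b = g y (Γ y e a) b + g y a (Γ y e b)

lemma minSmoothness_two_le : minSmoothness ℝ 2 ≤ ∞ := by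
  rw [minSmoothness_of_isRCLikeNormedField]
  exact WithTop.coe_le_coe.2 (le_top : (2 : ℕ∞) ≤ ⊤)

namespace LocalMetric

variable (S : LocalMetric E)

/-- The curvature `R(u, v) w` of the connection. -/
def curv (y u v w : E) : E :=
  fderiv ℝ S.Γ y u v w - fderiv ℝ S.Γ y v u w + S.Γ y u (S.Γ y v w) - S.Γ y v (S.Γ y u w)

/-- The curvature tensor `R_{abcf} = g(a, R(c, f) b)`. -/
def riem (y a b c f : E) : ℝ := S.g y a (S.curv y c f b)

/-- The covariant derivative of a vector field. -/
def nabla (V : E → E) (y e : E) : E := fderiv ℝ V y e + S.Γ y e (V y)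

/-- The covariant derivative of a tensor field of type `(0, 2)`. -/
def nabla₂ (T : E → E → E → ℝ) (y e a b : E) : ℝ :=
  fderiv ℝ (fun z => T z a b) y e - T y (S.Γ y e a) b - T y a (S.Γ y e b)

/-- The covariant derivative of a tensor field of type `(0, 4)`. -/
def nabla₄ (T : E → E → E → E → E → ℝ) (y e a b c f : E) : ℝ :=
  fderiv ℝ (fun z => T z a b c f) y e - T y (S.Γ y e a) b c f - T y a (S.Γ y e b) c f
    - T y a b (S.Γ y e c) f - T y a b c (S.Γ y e f)

variable {S} {y : E}

lemma contDiffAt_Γ (hy : y ∈ S.U) : ContDiffAt ℝ ∞ S.Γ y :=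
  S.contDiffOn_Γ.contDiffAt (S.isOpen.mem_nhds hy)

lemma contDiffAt_g (hy : y ∈ S.U) : ContDiffAt ℝ ∞ S.g y :=
  S.contDiffOn_g.contDiffAt (S.isOpen.mem_nhds hy)

lemma hasFDerivAt_Γ (hy : y ∈ S.U) : HasFDerivAt S.Γ (fderiv ℝ S.Γ y) y :=
  ((contDiffAt_Γ hy).differentiableAt (by simp)).hasFDerivAt

lemma hasFDerivAt_g (hy : y ∈ S.U) : HasFDerivAt S.g (fderiv ℝ S.g y) y :=
  ((contDiffAt_g hy).differentiableAt (by simp)).hasFDerivAt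

lemma hasFDerivAt_fderiv_Γ (hy : y ∈ S.U) :
    HasFDerivAt (fderiv ℝ S.Γ) (fderiv ℝ (fderiv ℝ S.Γ) y) y :=
  (((contDiffAt_Γ hy).fderiv_right (m := ∞) le_rfl).differentiableAt (by simp)).hasFDerivAt

lemma hasFDerivAt_fderiv_g (hy : y ∈ S.U) :
    HasFDerivAt (fderiv ℝ S.g) (fderiv ℝ (fderiv ℝ S.g) y) y :=
  (((contDiffAt_g hy).fderiv_right (m := ∞) le_rfl).differentiableAt (by simp)).hasFDerivAt

lemma fderiv_fderiv_Γ_symm (hy : y ∈ S.U) (u v : E) :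
    fderiv ℝ (fderiv ℝ S.Γ) y u v = fderiv ℝ (fderiv ℝ S.Γ) y v u :=
  (contDiffAt_Γ hy).isSymmSndFDerivAt minSmoothness_two_le u v

lemma fderiv_fderiv_g_symm (hy : y ∈ S.U) (u v : E) :
    fderiv ℝ (fderiv ℝ S.g) y u v = fderiv ℝ (fderiv ℝ S.g) y v u :=
  (contDiffAt_g hy).isSymmSndFDerivAt minSmoothness_two_le u v

lemma hasFDerivAt_Γ_apply (hy : y ∈ S.U) {V : E → E} {V' : E →L[ℝ] E}
    (hV : HasFDerivAt V V' y) (u : E) :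
    HasFDerivAt (fun z => S.Γ z u (V z))
      ((fderiv ℝ S.Γ y).flip u |>.flip (V y) |> fun A => A + (S.Γ y u).comp V') y := by
  have h := ((hasFDerivAt_Γ hy).clm_apply (hasFDerivAt_const u y)).clm_apply hV
  refine h.congr_fderiv ?_
  ext e
  simp [add_comm]

lemma hasFDerivAt_fderiv_Γ_apply (hy : y ∈ S.U) (u v w : E) :
    HasFDerivAt (fun z => fderiv ℝ S.Γ z u v w)
      (((fderiv ℝ (fderiv ℝ S.Γ) y).flip u).flip v |>.flip w) y := by
  have h := (((hasFDerivAt_fderiv_Γ hy).clm_apply (hasFDerivAt_const u y)).clm_apply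
    (hasFDerivAt_const v y)).clm_apply (hasFDerivAt_const w y)
  refine h.congr_fderiv ?_
  ext e
  simp

lemma hasFDerivAt_curv (hy : y ∈ S.U) (u v w : E) :
    DifferentiableAt ℝ (fun z => S.curv z u v w) y ∧
    ∀ e, fderiv ℝ (fun z => S.curv z u v w) y e =
      fderiv ℝ (fderiv ℝ S.Γ) y e u v w - fderiv ℝ (fderiv ℝ S.Γ) y e v u w
      + (fderiv ℝ S.Γ y e u (S.Γ y v w) + S.Γ y u (fderiv ℝ S.Γ y e v w))
      - (fderiv ℝ S.Γ y e v (S.Γ y u w) + S.Γ y v (fderiv ℝ S.Γ y e u w)) := by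
  have h0 : ∀ v, HasFDerivAt (fun z => S.Γ z v w) _ y := fun v =>
    hasFDerivAt_Γ_apply hy (hasFDerivAt_const w y) v
  have h := (((hasFDerivAt_fderiv_Γ_apply hy u v w).sub (hasFDerivAt_fderiv_Γ_apply hy v u w)).add
    (hasFDerivAt_Γ_apply hy (h0 v) u)).sub (hasFDerivAt_Γ_apply hy (h0 u) v)
  refine ⟨h.differentiableAt, fun e => ?_⟩
  have h1 : fderiv ℝ (fun z => S.curv z u v w) y = _ := h.fderiv
  rw [h1]
  simp

lemma fderiv_Γ_symm (hy : y ∈ S.U) (e u v : E) :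
    fderiv ℝ S.Γ y e u v = fderiv ℝ S.Γ y e v u := by
  have h : ∀ u v, HasFDerivAt (fun z => S.Γ z u v) _ y := fun u v =>
    hasFDerivAt_Γ_apply hy (hasFDerivAt_const v y) u
  have h1 := (h u v).unique ((h v u).congr_of_eventuallyEq
    (Filter.Eventually.of_forall fun z => S.Γ_symm z u v))
  simpa using congrArg (fun A => A e) h1

lemma curv_antisymm (y u v w : E) : S.curv y u v w = - S.curv y v u w := by
  simp only [curv]; abel

lemma curv_cyclic (hy : y ∈ S.U) (u v w : E) :
    S.curv y u v w + S.curv y v w u + S.curv y w u v = 0 := by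
  simp only [curv]
  rw [fderiv_Γ_symm hy u v w, fderiv_Γ_symm hy v u w, fderiv_Γ_symm hy w u v,
    S.Γ_symm y v w, S.Γ_symm y u w, S.Γ_symm y u v]
  abel

lemma isLinearMap_curv₁ (y v w : E) : IsLinearMap ℝ (fun u => S.curv y u v w) := by
  constructor <;> intros <;> simp [curv, smul_sub, smul_add]
  abel

lemma isLinearMap_curv₂ (y u w : E) : IsLinearMap ℝ (fun v => S.curv y u v w) := by
  constructor <;> intros <;> simp [curv, smul_sub, smul_add]
  abel

lemma isLinearMap_curv₃ (y u v : E) : IsLinearMap ℝ (fun w => S.curv y u v w) := by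
  constructor <;> intros <;> simp [curv, smul_sub, smul_add]
  abel

/-- The covariant derivative of the curvature endomorphism. -/
def nablaCurv (S : LocalMetric E) (y e u v w : E) : E :=
  fderiv ℝ (fun z => S.curv z u v w) y e + S.Γ y e (S.curv y u v w)
    - S.curv y (S.Γ y e u) v w - S.curv y u (S.Γ y e v) w - S.curv y u v (S.Γ y e w)

/-- The second Bianchi identity. -/
lemma bianchi (hy : y ∈ S.U) (e u v w : E) :
    S.nablaCurv y e u v w + S.nablaCurv y u v e w + S.nablaCurv y v e u w = 0 := by
  have h : ∀ e u v, S.nablaCurv y e u v w =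
      (fderiv ℝ (fun z => S.curv z u v w) y e + S.Γ y e (S.curv y u v w)
        - S.curv y u v (S.Γ y e w)) - S.curv y (S.Γ y e u) v w + S.curv y (S.Γ y v e) u w := by
    intro e u v
    rw [nablaCurv, curv_antisymm y u (S.Γ y e v), S.Γ_symm y v e]
    abel
  rw [h, h, h]
  simp only [(hasFDerivAt_curv hy _ _ _).2]
  rw [fderiv_fderiv_Γ_symm hy e u, fderiv_fderiv_Γ_symm hy e v, fderiv_fderiv_Γ_symm hy u v]
  simp only [curv, map_sub, map_add]
  abel

/-- Leibniz rule for the metric. -/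
lemma hasFDerivAt_g_apply (hy : y ∈ S.U) {V W : E → E}
    (hV : DifferentiableAt ℝ V y) (hW : DifferentiableAt ℝ W y) :
    DifferentiableAt ℝ (fun z => S.g z (V z) (W z)) y ∧
    ∀ e, fderiv ℝ (fun z => S.g z (V z) (W z)) y e =
      S.g y (S.nabla V y e) (W y) + S.g y (V y) (S.nabla W y e) := by
  have h := ((hasFDerivAt_g hy).clm_apply hV.hasFDerivAt).clm_apply hW.hasFDerivAt
  refine ⟨h.differentiableAt, fun e => ?_⟩
  rw [h.fderiv]
  simp [S.compat y hy, nabla]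
  ring

lemma nabla_const (a y e : E) : S.nabla (fun _ => a) y e = S.Γ y e a := by
  simp [nabla]

lemma riem_antisymm_right (y a b c f : E) : S.riem y a b c f = - S.riem y a b f c := by
  simp [riem, curv_antisymm y c f]

lemma riem_antisymm_left (hy : y ∈ S.U) (a b c f : E) :
    S.riem y a b c f = - S.riem y b a c f := by
  have key : ∀ u v, fderiv ℝ (fderiv ℝ S.g) y u v a b =
      S.g y (fderiv ℝ S.Γ y u v a) b + S.g y a (fderiv ℝ S.Γ y u v b)
      + S.g y (S.Γ y u (S.Γ y v a)) b + S.g y (S.Γ y v a) (S.Γ y u b)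
      + S.g y (S.Γ y u a) (S.Γ y v b) + S.g y a (S.Γ y u (S.Γ y v b)) := by
    intro u v
    have h1 := (((hasFDerivAt_fderiv_g hy).clm_apply (hasFDerivAt_const v y)).clm_apply
      (hasFDerivAt_const a y)).clm_apply (hasFDerivAt_const b y)
    have hΓ : ∀ a, HasFDerivAt (fun z => S.Γ z v a) _ y := fun a =>
      hasFDerivAt_Γ_apply hy (hasFDerivAt_const a y) v
    have h2 := hasFDerivAt_g_apply hy (hΓ a).differentiableAt (differentiableAt_const b)
    have h3 := hasFDerivAt_g_apply hy (differentiableAt_const a) (hΓ b).differentiableAt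
    have h4 : (fun z => fderiv ℝ S.g z v a b) =ᶠ[𝓝 y]
        fun z => S.g z (S.Γ z v a) b + S.g z a (S.Γ z v b) := by
      filter_upwards [S.isOpen.mem_nhds hy] with z hz using S.compat z hz v a b
    have h5 := h1.unique ((h2.1.hasFDerivAt.add h3.1.hasFDerivAt).congr_of_eventuallyEq h4)
    have h6 := congrArg (fun A => A u) h5
    simp only [add_apply, h2.2, h3.2, nabla_const] at h6
    simp [nabla, (hΓ a).fderiv, (hΓ b).fderiv] at h6
    rw [h6]; ring
  have h := fderiv_fderiv_g_symm hy c f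
  have h' := congrArg (fun A => A a b) h
  simp only [key] at h'
  simp only [riem, curv, map_sub, map_add]
  rw [S.g_symm y b, S.g_symm y b, S.g_symm y b, S.g_symm y b]
  linarith

lemma riem_cyclic (hy : y ∈ S.U) (a b c f : E) :
    S.riem y a b c f + S.riem y a c f b + S.riem y a f b c = 0 := by
  simp only [riem, ← map_add]
  have : S.curv y c f b + S.curv y f b c + S.curv y b c f = 0 := curv_cyclic hy c f b
  rw [this, map_zero]

lemma riem_pair (hy : y ∈ S.U) (a b c f : E) : S.riem y a b c f = S.riem y c f a b := by
  have hr := riem_antisymm_right (S := S) y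
  linarith [riem_cyclic hy a b c f, riem_cyclic hy b c f a, riem_cyclic hy c f a b,
    riem_cyclic hy f a b c, riem_antisymm_left hy a b c f, riem_antisymm_left hy a c f b,
    riem_antisymm_left hy a f b c, riem_antisymm_left hy b c f a, riem_antisymm_left hy b f a c,
    riem_antisymm_left hy c f a b, hr a b c f, hr b a f c, hr c a b f, hr c f a b, hr c b f a,
    hr f a b c, hr f b c a, hr b c f a, hr b f a c, hr f c a b, hr a c f b, hr a f b c]

lemma differentiableAt_riem (hy : y ∈ S.U) (a b c f : E) :
    DifferentiableAt ℝ (fun z => S.riem z a b c f) y :=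
  (hasFDerivAt_g_apply hy (differentiableAt_const a) (hasFDerivAt_curv hy c f b).1).1

lemma nabla₄_riem (hy : y ∈ S.U) (e a b c f : E) :
    S.nabla₄ S.riem y e a b c f = S.g y a (S.nablaCurv y e c f b) := by
  have h := (hasFDerivAt_g_apply hy (differentiableAt_const a) (hasFDerivAt_curv hy c f b).1).2 e
  rw [nabla_const, nabla] at h
  simp only [nabla₄, riem, nablaCurv, h, map_add, map_sub]
  ring

lemma nabla₄_riem_bianchi (hy : y ∈ S.U) (e a b c f : E) :
    S.nabla₄ S.riem y e a b c f + S.nabla₄ S.riem y c a b f e +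
      S.nabla₄ S.riem y f a b e c = 0 := by
  rw [nabla₄_riem hy, nabla₄_riem hy, nabla₄_riem hy, ← map_add, ← map_add, bianchi hy, map_zero]

/-- The Ricci identity for a vector field. -/
lemma ricci_identity (hy : y ∈ S.U) {V : E → E} (hV : ContDiffAt ℝ ∞ V y) (a e v : E) :
    S.nabla₂ (fun z a b => S.g z a (S.nabla V z b)) y e a v
      - S.nabla₂ (fun z a b => S.g z a (S.nabla V z b)) y v a e = S.riem y a (V y) e v := by
  have hV1 : DifferentiableAt ℝ V y := hV.differentiableAt (by simp)
  have hV2 : HasFDerivAt (fderiv ℝ V) (fderiv ℝ (fderiv ℝ V) y) y :=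
    ((hV.fderiv_right (m := ∞) le_rfl).differentiableAt (by simp)).hasFDerivAt
  have hsymm := hV.isSymmSndFDerivAt minSmoothness_two_le e v
  have hn : ∀ v, HasFDerivAt (fun z => S.nabla V z v) _ y := fun v =>
    (hV2.clm_apply (hasFDerivAt_const v y)).add (hasFDerivAt_Γ_apply hy hV1.hasFDerivAt v)
  have h := fun e v => (hasFDerivAt_g_apply hy (differentiableAt_const a)
    (hn v).differentiableAt).2 e
  simp only [nabla₂, h, nabla_const, riem, curv]
  have hn' : ∀ e v, S.nabla (fun z => S.nabla V z v) y e = fderiv ℝ (fderiv ℝ V) y e v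
      + (fderiv ℝ S.Γ y e v (V y) + S.Γ y v (fderiv ℝ V y e))
      + S.Γ y e (fderiv ℝ V y v + S.Γ y v (V y)) := by
    intro e v
    rw [nabla, (hn v).fderiv]
    simp [nabla]
  simp only [hn']
  rw [S.Γ_symm y v e, hsymm]
  simp only [map_add, map_sub]
  ring

end LocalMetric

end Local

section LinearAlgebra

variable {E : Type*} [NormedAddCommGroup E] [NormedSpace ℝ E] {N : ℕ}

/-- `l, n, m_i` is a null frame for the symmetric form `B`. -/
structure IsNullTetrad (B : E →L[ℝ] E →L[ℝ] ℝ) (l n : E) (m : Fin N → E) : Prop where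
  l_l : B l l = 0
  n_n : B n n = 0
  l_m : ∀ i, B l (m i) = 0
  n_m : ∀ i, B n (m i) = 0
  l_n : B l n = 1
  m_m : ∀ i j, B (m i) (m j) = if i = j then 1 else 0

namespace IsNullTetrad

variable {B : E →L[ℝ] E →L[ℝ] ℝ} {l n : E} {m : Fin N → E}

lemma linearIndependent (hB : ∀ u v, B u v = B v u) (h : IsNullTetrad B l n m) :
    LinearIndependent ℝ (Sum.elim ![l, n] m) := by
  rw [Fintype.linearIndependent_iff]
  intro c hc
  simp only [Fintype.sum_sum_type, Sum.elim_inl, Sum.elim_inr, Fin.sum_univ_two,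
    Matrix.cons_val_zero, Matrix.cons_val_one] at hc
  have h1 := congrArg (B l) hc
  have h2 := congrArg (B n) hc
  have h3 := fun j => congrArg (B (m j)) hc
  simp [h.l_l, h.l_n, h.l_m] at h1
  simp [hB n l, h.n_n, h.l_n, h.n_m] at h2
  simp [hB _ l, hB _ n, h.n_m, h.l_m, h.m_m] at h3
  rintro (i | i)
  · fin_cases i
    · simpa using h2
    · simpa using h1
  · exact h3 i

/-- Expansion of a vector in a null frame. -/
lemma expand [FiniteDimensional ℝ E] (hE : Module.finrank ℝ E = N + 2)
    (hB : ∀ u v, B u v = B v u) (h : IsNullTetrad B l n m) (u : E) :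
    u = B u n • l + B u l • n + ∑ i, B u (m i) • m i := by
  have hs := (h.linearIndependent hB).span_eq_top_of_card_eq_finrank' (by simp [hE, add_comm])
  have hu : u ∈ Submodule.span ℝ (Set.range (Sum.elim ![l, n] m)) := hs ▸ Submodule.mem_top
  induction hu using Submodule.span_induction with
  | mem x hx =>
    obtain ⟨i | i, rfl⟩ := hx
    · fin_cases i
      · simp [h.l_l, h.l_n, h.l_m]
      · simp [hB n l, h.n_n, h.l_n, h.n_m]
    · simp [hB _ l, hB _ n, h.n_m, h.l_m, h.m_m]
  | zero => simp
  | add x y _ _ hx hy =>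
    nth_rewrite 1 [hx, hy]
    simp only [map_add, add_apply, add_smul, Finset.sum_add_distrib]
    abel
  | smul a x _ hx =>
    nth_rewrite 1 [hx]
    simp only [map_smul, smul_apply, smul_eq_mul, mul_smul, smul_add,
      Finset.smul_sum]

lemma apply_eq [FiniteDimensional ℝ E] (hE : Module.finrank ℝ E = N + 2)
    (hB : ∀ u v, B u v = B v u) (h : IsNullTetrad B l n m) {F : Type*} [AddCommGroup F] [Module ℝ F]
    {f : E → F} (hf : IsLinearMap ℝ f) (u : E) :
    f u = B u n • f l + B u l • f n + ∑ i, B u (m i) • f (m i) := by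
  have := congrArg (hf.mk' f) (h.expand hE hB u)
  simpa only [map_add, map_sum, map_smul, IsLinearMap.mk'_apply] using this

/-- A null vector with nonzero product with `l` is, after rescaling, the second vector of a
null frame. -/
lemma exists_of_null (hB : ∀ u v, B u v = B v u) (h : IsNullTetrad B l n m) {k : E}
    (hk : B k k = 0) (hkl : B l k ≠ 0) :
    IsNullTetrad B l ((B l k)⁻¹ • k) (fun i => m i - ((B l k)⁻¹ * B k (m i)) • l) := by
  constructor
  · exact h.l_l
  · simp [hk]
  · intro i; simp [h.l_l, h.l_m]
  · intro i; simp [hB k l]; field_simp; simp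
  · simp [hkl]
  · intro i j; simp [h.l_l, h.l_m, h.m_m, hB (m i) l]

/-- Orthogonal null vectors are parallel. -/
lemma eq_smul_of_null [FiniteDimensional ℝ E] (hE : Module.finrank ℝ E = N + 2)
    (hB : ∀ u v, B u v = B v u) (h : IsNullTetrad B l n m) {k : E}
    (hk : B k k = 0) (hkl : B k l = 0) : k = B k n • l := by
  have h1 := h.expand hE hB k
  have h2 : B k k = ∑ i, B k (m i) * B k (m i) := by
    nth_rewrite 2 [h1]
    simp [hkl]
  have h3 : ∀ i, B k (m i) = 0 := by
    intro i
    have := (Finset.sum_eq_zero_iff_of_nonneg (fun i _ => mul_self_nonneg (B k (m i)))).1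
      (h2 ▸ hk) i (Finset.mem_univ i)
    simpa using this
  simpa [hkl, h3] using h1

end IsNullTetrad

/-- Leibniz rule for a differentiable family of linear forms. -/
lemma hasFDerivAt_linear_family [FiniteDimensional ℝ E] {f : E → E → ℝ} {y : E} {V : E → E}
    (hf : ∀ z, IsLinearMap ℝ (f z)) (hd : ∀ u, DifferentiableAt ℝ (fun z => f z u) y)
    (hV : DifferentiableAt ℝ V y) :
    DifferentiableAt ℝ (fun z => f z (V z)) y ∧
    ∀ e, fderiv ℝ (fun z => f z (V z)) y e =
      fderiv ℝ (fun z => f z (V y)) y e + f y (fderiv ℝ V y e) := by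
  let b := Module.finBasis ℝ E
  let c : ∀ i, E →L[ℝ] ℝ := fun i => LinearMap.toContinuousLinearMap (b.coord i)
  have hexp : ∀ z u, f z u = ∑ i, c i u * f z (b i) := by
    intro z u
    conv_lhs => rw [← b.sum_repr u]
    have := map_sum ((hf z).mk' (f z)) (fun i => b.repr u i • b i) Finset.univ
    simpa [(hf z).map_smul, c] using this
  have h1 := HasFDerivAt.fun_sum (u := Finset.univ) fun i _ =>
    ((c i).hasFDerivAt.comp y hV.hasFDerivAt).mul (hd (b i)).hasFDerivAt
  have h2 := HasFDerivAt.fun_sum (u := Finset.univ) fun i _ =>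
    (hd (b i)).hasFDerivAt.const_mul (c i (V y))
  have e1 : (fun z => f z (V z)) = fun z => ∑ i, (c i ∘ V) z * f z (b i) := by
    funext z; rw [hexp]; rfl
  have e2 : (fun z => f z (V y)) = fun z => ∑ i, c i (V y) * f z (b i) := by
    funext z; rw [hexp]
  rw [e1, e2]
  refine ⟨h1.differentiableAt, fun e => ?_⟩
  rw [h2.fderiv, hexp y (fderiv ℝ V y e)]
  have h1' := h1.fderiv
  simp only [Pi.mul_apply, Function.comp_apply] at h1' ⊢
  erw [h1']
  simp [Finset.sum_add_distrib, mul_comm]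

end LinearAlgebra

section Radiation

variable {E : Type*} [NormedAddCommGroup E] [NormedSpace ℝ E] {N : ℕ}

/-- A metric on an open set with two vector fields `l`, `k` and the parameters of a Ricci tensor
`lam g + η k k`. -/
structure RadiationField (E : Type*) [NormedAddCommGroup E] [NormedSpace ℝ E]
    extends LocalMetric E where
  l : E → E
  k : E → E
  η : E → ℝ
  lam : ℝ
  contDiffOn_l : ContDiffOn ℝ ∞ l U
  contDiffOn_k : ContDiffOn ℝ ∞ k U
  contDiffOn_η : ContDiffOn ℝ ∞ η U

namespace RadiationField

variable (S : RadiationField E)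

/-- The trace-free part `η k k` of the Ricci tensor. -/
def phi (y a b : E) : ℝ := S.η y * (S.g y (S.k y) a * S.g y (S.k y) b)

/-- The Weyl tensor of a metric in dimension `N + 2` with Ricci tensor `lam g + η k k`. -/
def weylT (N : ℕ) (y a b c f : E) : ℝ :=
  S.riem y a b c f
    - (N : ℝ)⁻¹ * (S.g y a c * S.phi y f b - S.g y a f * S.phi y c b
        - S.g y b c * S.phi y f a + S.g y b f * S.phi y c a)
    - S.lam / (N + 1) * (S.g y a c * S.g y f b - S.g y a f * S.g y c b)

variable {S} {y : E}

lemma contDiffAt_k (hy : y ∈ S.U) : ContDiffAt ℝ ∞ S.k y :=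
  S.contDiffOn_k.contDiffAt (S.isOpen.mem_nhds hy)

lemma differentiableAt_l (hy : y ∈ S.U) : DifferentiableAt ℝ S.l y :=
  (S.contDiffOn_l.contDiffAt (S.isOpen.mem_nhds hy)).differentiableAt (by simp)

lemma differentiableAt_k (hy : y ∈ S.U) : DifferentiableAt ℝ S.k y :=
  (contDiffAt_k hy).differentiableAt (by simp)

lemma differentiableAt_η (hy : y ∈ S.U) : DifferentiableAt ℝ S.η y :=
  (S.contDiffOn_η.contDiffAt (S.isOpen.mem_nhds hy)).differentiableAt (by simp)

lemma phi_symm (a b : E) : S.phi y a b = S.phi y b a := by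
  simp only [phi]; ring

lemma hasFDerivAt_g_const (hy : y ∈ S.U) (a b : E) :
    DifferentiableAt ℝ (fun z => S.g z a b) y ∧ ∀ e, fderiv ℝ (fun z => S.g z a b) y e =
      S.g y (S.Γ y e a) b + S.g y a (S.Γ y e b) := by
  simpa only [LocalMetric.nabla_const] using LocalMetric.hasFDerivAt_g_apply hy
    (differentiableAt_const a) (differentiableAt_const b)

lemma hasFDerivAt_g_field (hy : y ∈ S.U) {V : E → E} (hV : DifferentiableAt ℝ V y) (b : E) :
    DifferentiableAt ℝ (fun z => S.g z (V z) b) y ∧ ∀ e, fderiv ℝ (fun z => S.g z (V z) b) y e =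
      S.g y (S.nabla V y e) b + S.g y (V y) (S.Γ y e b) := by
  simpa only [LocalMetric.nabla_const] using LocalMetric.hasFDerivAt_g_apply hy
    hV (differentiableAt_const b)

lemma differentiableAt_phi (hy : y ∈ S.U) (a b : E) :
    DifferentiableAt ℝ (fun z => S.phi z a b) y :=
  (differentiableAt_η hy).mul ((hasFDerivAt_g_field hy (differentiableAt_k hy) a).1.mul
    (hasFDerivAt_g_field hy (differentiableAt_k hy) b).1)

lemma nabla₂_phi (hy : y ∈ S.U) (e a b : E) :
    S.nabla₂ S.phi y e a b = fderiv ℝ S.η y e * (S.g y (S.k y) a * S.g y (S.k y) b)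
      + S.η y * (S.g y (S.nabla S.k y e) a * S.g y (S.k y) b
        + S.g y (S.k y) a * S.g y (S.nabla S.k y e) b) := by
  have ha := hasFDerivAt_g_field hy (differentiableAt_k hy) a
  have hb := hasFDerivAt_g_field hy (differentiableAt_k hy) b
  have h := ((differentiableAt_η hy).hasFDerivAt.mul
    (ha.1.hasFDerivAt.mul hb.1.hasFDerivAt)).fderiv
  have h' : fderiv ℝ (fun z => S.phi z a b) y = _ := h
  rw [LocalMetric.nabla₂, h']
  simp [ha.2, hb.2, phi]
  ring

lemma isLinearMap_phi (b : E) : IsLinearMap ℝ (fun a => S.phi y a b) := by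
  constructor <;> intros <;> simp [phi] <;> ring

lemma differentiableAt_weylT (hy : y ∈ S.U) (a b c f : E) :
    DifferentiableAt ℝ (fun z => S.weylT N z a b c f) y := by
  have hr := LocalMetric.differentiableAt_riem hy a b c f
  have hg := fun a b => (hasFDerivAt_g_const hy a b).1
  have hp := fun a b => differentiableAt_phi hy a b
  unfold weylT
  fun_prop

lemma nabla₄_weylT (hy : y ∈ S.U) (e a b c f : E) :
    S.nabla₄ (S.weylT N) y e a b c f = S.nabla₄ S.riem y e a b c f
      - (N : ℝ)⁻¹ * (S.g y a c * S.nabla₂ S.phi y e f b - S.g y a f * S.nabla₂ S.phi y e c b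
        - S.g y b c * S.nabla₂ S.phi y e f a + S.g y b f * S.nabla₂ S.phi y e c a) := by
  have hr := (LocalMetric.differentiableAt_riem hy a b c f).hasFDerivAt
  have hg := fun a b => (hasFDerivAt_g_const hy a b).1.hasFDerivAt
  have hg' := fun a b => (hasFDerivAt_g_const hy a b).2
  have hp := fun a b => (differentiableAt_phi hy a b).hasFDerivAt
  have h := ((hr.sub (((((hg a c).mul (hp f b)).sub ((hg a f).mul (hp c b))).sub
    ((hg b c).mul (hp f a))).add ((hg b f).mul (hp c a)) |>.const_mul ((N : ℝ)⁻¹))).sub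
    ((((hg a c).mul (hg f b)).sub ((hg a f).mul (hg c b))).const_mul
      (S.lam / (N + 1)))).fderiv
  have h' : fderiv ℝ (fun z => S.weylT N z a b c f) y = _ := h
  rw [LocalMetric.nabla₄, h']
  simp [hg', LocalMetric.nabla₄, LocalMetric.nabla₂, weylT]
  ring

/-- The second Bianchi identity in terms of the Weyl tensor. -/
lemma weylT_bianchi (hy : y ∈ S.U) (e c f a b : E) :
    (S.nabla₄ (S.weylT N) y e a b c f + S.nabla₄ (S.weylT N) y c a b f e
      + S.nabla₄ (S.weylT N) y f a b e c)
    + (N : ℝ)⁻¹ * (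
      (S.g y a c * S.nabla₂ S.phi y e f b - S.g y a f * S.nabla₂ S.phi y e c b
        - S.g y b c * S.nabla₂ S.phi y e f a + S.g y b f * S.nabla₂ S.phi y e c a)
      + (S.g y a f * S.nabla₂ S.phi y c e b - S.g y a e * S.nabla₂ S.phi y c f b
        - S.g y b f * S.nabla₂ S.phi y c e a + S.g y b e * S.nabla₂ S.phi y c f a)
      + (S.g y a e * S.nabla₂ S.phi y f c b - S.g y a c * S.nabla₂ S.phi y f e b
        - S.g y b e * S.nabla₂ S.phi y f c a + S.g y b c * S.nabla₂ S.phi y f e a)) = 0 := by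
  have := LocalMetric.nabla₄_riem_bianchi hy e a b c f
  rw [nabla₄_weylT hy, nabla₄_weylT hy, nabla₄_weylT hy]
  linear_combination this

lemma weylT_antisymm_right (a b c f : E) : S.weylT N y a b c f = - S.weylT N y a b f c := by
  rw [weylT, weylT, LocalMetric.riem_antisymm_right y a b c f]
  ring

lemma weylT_antisymm_left (hy : y ∈ S.U) (a b c f : E) :
    S.weylT N y a b c f = - S.weylT N y b a c f := by
  rw [weylT, weylT, LocalMetric.riem_antisymm_left hy a b c f, S.g_symm y f b, S.g_symm y f a,
    S.g_symm y c a, S.g_symm y c b]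
  ring

lemma weylT_pair (hy : y ∈ S.U) (a b c f : E) : S.weylT N y a b c f = S.weylT N y c f a b := by
  rw [weylT, weylT, LocalMetric.riem_pair hy a b c f, S.g_symm y f b, S.g_symm y c a,
    S.g_symm y c b, S.g_symm y f a, S.g_symm y b f, phi_symm f b, phi_symm c b, phi_symm f a,
    phi_symm c a]
  ring

lemma isLinearMap_weylT (b c f : E) : IsLinearMap ℝ (fun a => S.weylT N y a b c f) := by
  constructor <;> intros <;>
    simp [weylT, LocalMetric.riem, phi] <;> ring

lemma fderiv_congr (hy : y ∈ S.U) {f₁ f₂ : E → ℝ} (h : ∀ z ∈ S.U, f₁ z = f₂ z) :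
    fderiv ℝ f₁ y = fderiv ℝ f₂ y :=
  Filter.EventuallyEq.fderiv_eq (by
    filter_upwards [S.isOpen.mem_nhds hy] with z hz using h z hz)

lemma nabla₄_weylT_antisymm_right (hy : y ∈ S.U) (e a b c f : E) :
    S.nabla₄ (S.weylT N) y e a b c f = - S.nabla₄ (S.weylT N) y e a b f c := by
  have h : fderiv ℝ (fun z => S.weylT N z a b c f) y =
      - fderiv ℝ (fun z => S.weylT N z a b f c) y := by
    rw [← fderiv_fun_neg]; exact fderiv_congr hy fun z _ => weylT_antisymm_right a b c f
  simp only [LocalMetric.nabla₄, h, neg_apply]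
  rw [weylT_antisymm_right _ b c f, weylT_antisymm_right a _ c f,
    weylT_antisymm_right a b (S.Γ y e c), weylT_antisymm_right a b c]
  ring

lemma nabla₄_weylT_antisymm_left (hy : y ∈ S.U) (e a b c f : E) :
    S.nabla₄ (S.weylT N) y e a b c f = - S.nabla₄ (S.weylT N) y e b a c f := by
  have h : fderiv ℝ (fun z => S.weylT N z a b c f) y =
      - fderiv ℝ (fun z => S.weylT N z b a c f) y := by
    rw [← fderiv_fun_neg]; exact fderiv_congr hy fun z hz => weylT_antisymm_left hz a b c f
  simp only [LocalMetric.nabla₄, h, neg_apply]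
  rw [weylT_antisymm_left hy _ b, weylT_antisymm_left hy a (S.Γ y e b),
    weylT_antisymm_left hy a b (S.Γ y e c), weylT_antisymm_left hy a b c]
  ring

lemma nabla₄_weylT_pair (hy : y ∈ S.U) (e a b c f : E) :
    S.nabla₄ (S.weylT N) y e a b c f = S.nabla₄ (S.weylT N) y e c f a b := by
  have h : fderiv ℝ (fun z => S.weylT N z a b c f) y = fderiv ℝ (fun z => S.weylT N z c f a b) y :=
    fderiv_congr hy fun z hz => weylT_pair hz a b c f
  simp only [LocalMetric.nabla₄, h]
  rw [weylT_pair hy (S.Γ y e a), weylT_pair hy a (S.Γ y e b),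
    weylT_pair hy a b (S.Γ y e c), weylT_pair hy a b c]
  ring

/-- Weyl type N with multiple WAND `l`, for a null field `k`. -/
structure IsTypeN (S : RadiationField E) (N : ℕ) : Prop where
  two_le : 2 ≤ N
  finrank : Module.finrank ℝ E = N + 2
  k_null : ∀ y ∈ S.U, S.g y (S.k y) (S.k y) = 0
  k_ne : ∀ y ∈ S.U, S.k y ≠ 0
  exists_tetrad : ∀ y ∈ S.U, ∃ (n : E) (m : Fin N → E), IsNullTetrad (S.g y) (S.l y) n m
  weyl_l : ∀ y ∈ S.U, ∀ b c f, S.weylT N y (S.l y) b c f = 0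
  weyl_perp : ∀ y ∈ S.U, ∀ a b c f, S.g y (S.l y) a = 0 → S.g y (S.l y) b = 0 →
    S.weylT N y a b c f = 0
  weyl_trace : ∀ y ∈ S.U, ∀ (n : E) (m : Fin N → E), IsNullTetrad (S.g y) (S.l y) n m →
    ∑ i, S.weylT N y n (m i) n (m i) = 0
  weyl_ne : ∀ y ∈ S.U, ∃ a b c f, S.weylT N y a b c f ≠ 0

namespace IsTypeN

lemma g_l_l (h : S.IsTypeN N) (hy : y ∈ S.U) : S.g y (S.l y) (S.l y) = 0 := by
  obtain ⟨n, m, ht⟩ := h.exists_tetrad y hy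
  exact ht.l_l

lemma nabla_l_perp (h : S.IsTypeN N) (hy : y ∈ S.U) (e : E) :
    S.g y (S.l y) (S.nabla S.l y e) = 0 := by
  have h1 := (LocalMetric.hasFDerivAt_g_apply hy
    (differentiableAt_l hy) (differentiableAt_l hy)).2 e
  have h2 := fderiv_congr hy (f₁ := fun z => S.g z (S.l z) (S.l z)) (f₂ := fun _ => 0)
    fun z hz => h.g_l_l hz
  rw [h2, S.g_symm y (S.nabla S.l y e)] at h1
  simp at h1
  linarith

lemma nabla_k_perp (h : S.IsTypeN N) (hy : y ∈ S.U) (e : E) :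
    S.g y (S.k y) (S.nabla S.k y e) = 0 := by
  have h1 := (LocalMetric.hasFDerivAt_g_apply hy
    (differentiableAt_k hy) (differentiableAt_k hy)).2 e
  have h2 := fderiv_congr hy (f₁ := fun z => S.g z (S.k z) (S.k z)) (f₂ := fun _ => 0)
    fun z hz => h.k_null z hz
  rw [h2, S.g_symm y (S.nabla S.k y e)] at h1
  simp at h1
  linarith

lemma nabla_weyl_l [FiniteDimensional ℝ E] (h : S.IsTypeN N) (hy : y ∈ S.U) (e b c f : E) :
    S.nabla₄ (S.weylT N) y e (S.l y) b c f = - S.weylT N y (S.nabla S.l y e) b c f := by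
  have h1 := (hasFDerivAt_linear_family (f := fun z a => S.weylT N z a b c f)
    (fun z => isLinearMap_weylT b c f) (fun u => differentiableAt_weylT hy u b c f)
    (differentiableAt_l hy)).2 e
  have h2 := fderiv_congr hy (f₁ := fun z => S.weylT N z (S.l z) b c f) (f₂ := fun _ => 0)
    fun z hz => h.weyl_l z hz b c f
  rw [h2] at h1
  simp only [fderiv_fun_const, Pi.zero_apply, zero_apply] at h1
  rw [LocalMetric.nabla₄, LocalMetric.nabla, (isLinearMap_weylT b c f).map_add, h.weyl_l y hy,
    h.weyl_l y hy, h.weyl_l y hy]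
  linarith

lemma weyl_eq {n : E} {m : Fin N → E} (h : S.IsTypeN N) (hy : y ∈ S.U)
    (ht : IsNullTetrad (S.g y) (S.l y) n m) (a b c f : E) :
    S.weylT N y a b c f = S.g y (S.l y) b * S.weylT N y a n c f
      - S.g y (S.l y) a * S.weylT N y b n c f := by
  have hl : ∀ a, S.g y (S.l y) (a - S.g y (S.l y) a • n) = 0 := by
    intro a; simp [ht.l_n]
  have h1 := h.weyl_perp y hy _ _ c f (hl a) (hl b)
  have hlin := fun b => isLinearMap_weylT (S := S) (N := N) (y := y) b c f
  have h0 : S.weylT N y n n c f = 0 := by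
    linarith [weylT_antisymm_left (N := N) hy n n c f]
  rw [(hlin _).map_sub, (hlin _).map_smul, weylT_antisymm_left hy a, weylT_antisymm_left hy n,
    (hlin _).map_sub, (hlin _).map_sub, (hlin _).map_smul, (hlin _).map_smul, h0,
    weylT_antisymm_left hy b a, weylT_antisymm_left hy n a] at h1
  simp only [smul_eq_mul] at h1
  linarith

lemma weyl_wedge (h : S.IsTypeN N) (hy : y ∈ S.U) (x a b c f : E) :
    S.g y (S.l y) x * S.weylT N y a b c f + S.g y (S.l y) a * S.weylT N y b x c f
      + S.g y (S.l y) b * S.weylT N y x a c f = 0 := by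
  obtain ⟨n, m, ht⟩ := h.exists_tetrad y hy
  rw [h.weyl_eq hy ht a b, h.weyl_eq hy ht b x, h.weyl_eq hy ht x a]
  ring

lemma nabla_weyl_wedge (h : S.IsTypeN N) (hy : y ∈ S.U) (e x a b c f : E) :
    S.g y (S.nabla S.l y e) x * S.weylT N y a b c f
      + S.g y (S.nabla S.l y e) a * S.weylT N y b x c f
      + S.g y (S.nabla S.l y e) b * S.weylT N y x a c f
      + S.g y (S.l y) x * S.nabla₄ (S.weylT N) y e a b c f
      + S.g y (S.l y) a * S.nabla₄ (S.weylT N) y e b x c f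
      + S.g y (S.l y) b * S.nabla₄ (S.weylT N) y e x a c f = 0 := by
  have hg := fun x => hasFDerivAt_g_field hy (differentiableAt_l hy) x
  have hw := fun a b => (differentiableAt_weylT (N := N) hy a b c f).hasFDerivAt
  have h1 := ((((hg x).1.hasFDerivAt.mul (hw a b)).add ((hg a).1.hasFDerivAt.mul (hw b x))).add
    ((hg b).1.hasFDerivAt.mul (hw x a))).fderiv
  have h2 := fderiv_congr hy (f₁ := fun z => S.g z (S.l z) x * S.weylT N z a b c f
      + S.g z (S.l z) a * S.weylT N z b x c f + S.g z (S.l z) b * S.weylT N z x a c f)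
      (f₂ := fun _ => 0) fun z hz => h.weyl_wedge hz x a b c f
  have h3 := congrArg (fun A => A e) (h2.symm.trans h1)
  simp [(hg _).2] at h3
  simp only [LocalMetric.nabla₄]
  linear_combination -h3 - h.weyl_wedge hy (S.Γ y e x) a b c f - h.weyl_wedge hy x (S.Γ y e a) b c f
    - h.weyl_wedge hy x a (S.Γ y e b) c f - h.weyl_wedge hy x a b (S.Γ y e c) f
    - h.weyl_wedge hy x a b c (S.Γ y e f)

end IsTypeN

end RadiationField

end Radiation

namespace RadiationField

namespace IsTypeN

variable {E : Type*} [NormedAddCommGroup E] [NormedSpace ℝ E] {N : ℕ}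
  {S : RadiationField E} {y : E}

lemma nabla_weyl_l_perp [FiniteDimensional ℝ E] (h : S.IsTypeN N) (hy : y ∈ S.U) (e b c f : E)
    (hb : S.g y (S.l y) b = 0) : S.nabla₄ (S.weylT N) y e (S.l y) b c f = 0 := by
  rw [h.nabla_weyl_l hy, h.weyl_perp y hy _ _ _ _ (h.nabla_l_perp hy e) hb, neg_zero]

lemma nabla_weyl_perp (h : S.IsTypeN N) (hy : y ∈ S.U) (e a b c f : E)
    (ha : S.g y (S.l y) a = 0) (hb : S.g y (S.l y) b = 0)
    (hc : S.g y (S.l y) c = 0) (hf : S.g y (S.l y) f = 0) :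
    S.nabla₄ (S.weylT N) y e a b c f = 0 := by
  obtain ⟨n, m, ht⟩ := h.exists_tetrad y hy
  have h0 : ∀ a b, S.weylT N y a b c f = 0 := fun a b => by
    rw [weylT_pair hy]; exact h.weyl_perp y hy _ _ _ _ hc hf
  have := h.nabla_weyl_wedge hy e n a b c f
  simpa [h0, ha, hb, ht.l_n] using this

/-- Where `η ≠ 0` and `k` is not orthogonal to `l`, the field `k` is Kundt. -/
lemma nabla_k_eq_zero [FiniteDimensional ℝ E] (h : S.IsTypeN N) (hy : y ∈ S.U) (hη : S.η y ≠ 0)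
    (hkl : S.g y (S.l y) (S.k y) ≠ 0) (u v : E) (hu : S.g y (S.k y) u = 0)
    (hv : S.g y (S.k y) v = 0) : S.g y u (S.nabla S.k y v) = 0 := by
  obtain ⟨n₀, m₀, ht₀⟩ := h.exists_tetrad y hy
  have ht := ht₀.exists_of_null (S.g_symm y) (h.k_null y hy) hkl
  have hN : (N : ℝ) ≠ 0 := by have := h.two_le; positivity
  generalize hm : (fun i => m₀ i - ((S.g y (S.l y) (S.k y))⁻¹ * S.g y (S.k y) (m₀ i)) • S.l y) = m
    at ht
  generalize hn : (S.g y (S.l y) (S.k y))⁻¹ • S.k y = n at ht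
  generalize hf : S.g y (S.l y) (S.k y) = f at *
  have hk : S.k y = f • n := by rw [← hn, smul_smul, mul_inv_cancel₀ hkl, one_smul]
  have hkl' : S.g y (S.k y) (S.l y) = f := by rw [S.g_symm, hf]
  have hkn : S.g y (S.k y) n = 0 := by simp [hk, ht.n_n]
  have hkm : ∀ i, S.g y (S.k y) (m i) = 0 := fun i => by simp [hk, ht.n_m]
  have hKn : ∀ e, S.g y (S.nabla S.k y e) n = 0 := fun e => by
    rw [S.g_symm, ← hn]; simp [h.nabla_k_perp hy e]
  have hlin := fun e a b => nabla₂_phi (S := S) hy e a b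
  have hPn : ∀ e b, S.nabla₂ S.phi y e n b = 0 := fun e b => by
    rw [hlin]; simp [hkn, hKn]
  have hPn' : ∀ e b, S.nabla₂ S.phi y e b n = 0 := fun e b => by
    rw [hlin]; simp [hkn, hKn]
  have hPm : ∀ e i j, S.nabla₂ S.phi y e (m i) (m j) = 0 := fun e i j => by
    rw [hlin]; simp [hkm]
  have hPl : ∀ e i, S.nabla₂ S.phi y e (m i) (S.l y) =
      S.η y * f * S.g y (S.nabla S.k y e) (m i) := fun e i => by
    rw [hlin, hkm, hkl']; ring
  have hPl' : ∀ e i, S.nabla₂ S.phi y e (S.l y) (m i) =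
      S.η y * f * S.g y (S.nabla S.k y e) (m i) := fun e i => by
    rw [hlin, hkm, hkl']; ring
  have hml : ∀ i, S.g y (m i) (S.l y) = 0 := fun i => by rw [S.g_symm, ht.l_m]
  have hmn : ∀ i, S.g y (m i) n = 0 := fun i => by rw [S.g_symm, ht.n_m]
  have hnl : S.g y n (S.l y) = 1 := by rw [S.g_symm, ht.l_n]
  have hψ : S.η y * f ≠ 0 := mul_ne_zero hη hkl
  have hWl := fun e j c f => h.nabla_weyl_l_perp hy e (m j) c f (ht.l_m j)
  have hWm : ∀ e i j p q, S.nabla₄ (S.weylT N) y e (m i) (m j) (m p) (m q) = 0 :=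
    fun e i j p q => h.nabla_weyl_perp hy _ _ _ _ _ (ht.l_m i) (ht.l_m j) (ht.l_m p) (ht.l_m q)
  have hWlast : ∀ e i j p, S.nabla₄ (S.weylT N) y e (m i) (m j) (m p) (S.l y) = 0 := by
    intro e i j p
    rw [nabla₄_weylT_pair hy, nabla₄_weylT_antisymm_left hy, hWl, neg_zero]
  have hWmid : ∀ e i j p, S.nabla₄ (S.weylT N) y e (m i) (m j) (S.l y) (m p) = 0 := by
    intro e i j p
    rw [nabla₄_weylT_pair hy, hWl]
  have eq1 : ∀ i j, S.η y * f * S.g y (S.nabla S.k y (m i)) (m j) =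
      - if i = j then S.nabla₂ S.phi y n (S.l y) (S.l y) else 0 := by
    intro i j
    have := weylT_bianchi (N := N) hy (S.l y) (m i) n (S.l y) (m j)
    simp [hWl, ht.l_n, ht.l_l, ht.l_m, hmn, hml, ht.m_m, hPn, hPm, hPl, hPl', hN,
      eq_comm (a := j)] at this
    linear_combination this
  have eq2 : ∀ i j, i ≠ j → S.η y * f * (S.g y (S.nabla S.k y (m i)) (m i)
      + S.g y (S.nabla S.k y (m j)) (m j)) = 0 := by
    intro i j hij
    have := weylT_bianchi (N := N) hy (S.l y) (m i) (m j) (m i) (m j)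
    simp [hWm, hWlast, hWmid, hml, ht.m_m, hPm, hPl', hN, hij, hij.symm] at this
    linear_combination -this
  have eq3 : ∀ i j, i ≠ j → S.g y (S.nabla S.k y n) (m i) = 0 := by
    intro i j hij
    have := weylT_bianchi (N := N) hy (m i) (m j) n (S.l y) (m j)
    simp [hWl, ht.l_n, ht.l_m, hmn, ht.m_m, hPn, hPm, hPl, hN, hij.symm, hη, hkl] at this
    exact this
  have hother : ∀ i : Fin N, ∃ j, i ≠ j := by
    intro i
    have : Nontrivial (Fin N) := Fin.nontrivial_iff_two_le.2 h.two_le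
    obtain ⟨j, hj⟩ := exists_ne i
    exact ⟨j, hj.symm⟩
  have hKn1 : ∀ i, S.g y (S.nabla S.k y n) (m i) = 0 := fun i => by
    obtain ⟨j, hj⟩ := hother i; exact eq3 i j hj
  have hKm : ∀ i j, S.g y (S.nabla S.k y (m i)) (m j) = 0 := by
    intro i j
    have hD : S.nabla₂ S.phi y n (S.l y) (S.l y) = 0 := by
      obtain ⟨j, hj⟩ := hother i
      have h1 := eq1 i i
      have h2 := eq1 j j
      have h3 := eq2 i j hj
      simp only [if_true] at h1 h2
      linarith
    have h1 := eq1 i j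
    rw [hD] at h1
    simpa [hη, hkl] using h1
  have hperp : ∀ u, S.g y (S.k y) u = 0 → S.g y u n = 0 := by
    intro u hu
    rw [S.g_symm, ← hn]
    simp [hu]
  have hlin_u : IsLinearMap ℝ (fun u => S.g y u (S.nabla S.k y v)) :=
    ⟨fun a b => by simp, fun c a => by simp⟩
  have hlin_v : ∀ a, IsLinearMap ℝ (fun v => S.g y a (S.nabla S.k y v)) := fun a => by
    constructor <;> intros <;> simp [LocalMetric.nabla] <;> ring
  rw [ht.apply_eq h.finrank (S.g_symm y) hlin_u u]
  simp only [hperp u hu, zero_smul, zero_add]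
  have h1 : ∀ i, S.g y (m i) (S.nabla S.k y v) = 0 := by
    intro i
    rw [ht.apply_eq h.finrank (S.g_symm y) (hlin_v (m i)) v]
    simp [hperp v hv, S.g_symm y (m i), hKn1, hKm]
  simp [h1, S.g_symm y n, hKn]

lemma differentiableAt_nabla (hy : y ∈ S.U) {V : E → E} (hV : ContDiffAt ℝ ∞ V y) (v : E) :
    DifferentiableAt ℝ (fun z => S.nabla V z v) y := by
  have hV2 : HasFDerivAt (fderiv ℝ V) (fderiv ℝ (fderiv ℝ V) y) y :=
    ((hV.fderiv_right (m := ∞) le_rfl).differentiableAt (by simp)).hasFDerivAt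
  exact ((hV2.clm_apply (hasFDerivAt_const v y)).add (LocalMetric.hasFDerivAt_Γ_apply hy
    (hV.differentiableAt (by simp)).hasFDerivAt v)).differentiableAt

/-- The components `C(n, m_i, n, m_j)` of a Weyl tensor of type N do not all vanish. -/
lemma exists_weyl_ne [FiniteDimensional ℝ E] {n : E} {m : Fin N → E} (h : S.IsTypeN N)
    (hy : y ∈ S.U) (ht : IsNullTetrad (S.g y) (S.l y) n m) :
    ∃ i j, S.weylT N y n (m i) n (m j) ≠ 0 := by
  by_contra! h0
  have hflip : ∀ a c, S.weylT N y a n c n = S.weylT N y n a n c := fun a c => by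
    rw [weylT_antisymm_left hy, weylT_antisymm_right]; ring
  have hnn : ∀ c f, S.weylT N y n n c f = 0 := fun c f => by
    linarith [weylT_antisymm_left (N := N) hy n n c f]
  have h1 : ∀ a b, S.weylT N y a n b n = 0 := by
    intro a b
    rw [ht.apply_eq h.finrank (S.g_symm y) (isLinearMap_weylT n b n) a]
    simp only [h.weyl_l y hy, hnn, smul_zero, zero_add]
    refine Finset.sum_eq_zero fun i _ => ?_
    rw [weylT_pair hy, ht.apply_eq h.finrank (S.g_symm y) (isLinearMap_weylT n (m i) n) b]
    simp only [h.weyl_l y hy, hnn, smul_zero, zero_add, hflip, h0]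
    simp
  obtain ⟨a, b, c, f, hne⟩ := h.weyl_ne y hy
  apply hne
  have h2 : ∀ a, S.weylT N y a n c f = 0 := fun a => by
    rw [weylT_pair hy, h.weyl_eq hy ht, h1, h1]; ring
  rw [h.weyl_eq hy ht, h2, h2]; ring

/-- If the field `k` is Kundt near `y`, the curvature components `R(u, k, k, v)` with `u, v`
orthogonal to `k` vanish. -/
lemma riem_k_eq_zero (h : S.IsTypeN N) (hy : y ∈ S.U) {x : E} (hx : S.g y (S.k y) x ≠ 0)
    (hK : ∀ᶠ z in 𝓝 y, ∀ u v, S.g z (S.k z) u = 0 → S.g z (S.k z) v = 0 →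
      S.g z u (S.nabla S.k z v) = 0) (u v : E) (hu : S.g y (S.k y) u = 0)
    (hv : S.g y (S.k y) v = 0) : S.riem y u (S.k y) (S.k y) v = 0 := by
  set T : E → E → E → ℝ := fun z a b => S.g z a (S.nabla S.k z b) with hT
  have hTlin₁ : ∀ z b, IsLinearMap ℝ (fun a => T z a b) := fun z b =>
    ⟨fun a c => by simp [hT], fun c a => by simp [hT]⟩
  have hTlin₂ : ∀ z a, IsLinearMap ℝ (fun b => T z a b) := fun z a => by
    constructor <;> intros <;> simp [hT, LocalMetric.nabla] <;> ring
  have key : ∀ z, (∀ u v, S.g z (S.k z) u = 0 → S.g z (S.k z) v = 0 → T z u v = 0) → ∀ a b,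
      S.g z (S.k z) x * S.g z (S.k z) x * T z a b
      - S.g z (S.k z) a * S.g z (S.k z) x * T z x b
      - S.g z (S.k z) x * S.g z (S.k z) b * T z a x
      + S.g z (S.k z) a * S.g z (S.k z) b * T z x x = 0 := by
    intro z hz a b
    have := hz (S.g z (S.k z) x • a - S.g z (S.k z) a • x)
      (S.g z (S.k z) x • b - S.g z (S.k z) b • x)
      (by simp [mul_comm]) (by simp [mul_comm])
    rw [(hTlin₁ z _).map_sub, (hTlin₁ z _).map_smul, (hTlin₁ z _).map_smul,
      (hTlin₂ z _).map_sub, (hTlin₂ z _).map_sub, (hTlin₂ z _).map_smul, (hTlin₂ z _).map_smul,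
      (hTlin₂ z _).map_smul, (hTlin₂ z _).map_smul] at this
    simp only [smul_eq_mul] at this
    linear_combination this
  have hK' := hK.self_of_nhds
  have hTd : ∀ a b, DifferentiableAt ℝ (fun z => T z a b) y := fun a b =>
    (LocalMetric.hasFDerivAt_g_apply hy (differentiableAt_const a)
      (differentiableAt_nabla hy (contDiffAt_k hy) b)).1
  have hg := fun x => hasFDerivAt_g_field hy (differentiableAt_k hy) x
  have hD : ∀ e v, S.g y (S.k y) v = 0 → S.g y (S.k y) x * S.nabla₂ T y e u v =
      S.g y (S.nabla S.k y e) u * T y x v + S.g y (S.nabla S.k y e) v * T y u x := by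
    intro e v hv
    have hgd := fun x => (hg x).1.hasFDerivAt
    have h1 := ((((((hgd x).mul (hgd x)).mul (hTd u v).hasFDerivAt).sub
      (((hgd u).mul (hgd x)).mul (hTd x v).hasFDerivAt)).sub
      (((hgd x).mul (hgd v)).mul (hTd u x).hasFDerivAt)).add
      (((hgd u).mul (hgd v)).mul (hTd x x).hasFDerivAt)).fderiv
    have h2 : fderiv ℝ (fun z => S.g z (S.k z) x * S.g z (S.k z) x * T z u v
      - S.g z (S.k z) u * S.g z (S.k z) x * T z x v
      - S.g z (S.k z) x * S.g z (S.k z) v * T z u x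
      + S.g z (S.k z) u * S.g z (S.k z) v * T z x x) y = fderiv ℝ (fun _ => 0) y :=
      Filter.EventuallyEq.fderiv_eq (by filter_upwards [hK] with z hz using key z hz u v)
    have h3 := congrArg (fun A => A e) (h2.symm.trans h1)
    simp [(hg _).2, hu, hv] at h3
    have k1 := key y hK' (S.Γ y e u) v
    have k2 := key y hK' u (S.Γ y e v)
    rw [hv] at k1
    rw [hu] at k2
    have h0 : T y u v = 0 := hK' u v hu hv
    apply mul_left_cancel₀ hx
    rw [LocalMetric.nabla₂]
    linear_combination -h3 - k1 - k2 - (2 * S.g y (S.k y) x *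
      (S.g y (S.nabla S.k y e) x + S.g y (S.k y) (S.Γ y e x))) * h0
  have hkk := h.k_null y hy
  have hr := LocalMetric.ricci_identity hy (contDiffAt_k hy) u (S.k y) v
  have h1 := hD (S.k y) v hv
  have h2 := hD v (S.k y) hkk
  rw [S.g_symm y _ u, S.g_symm y _ v, hK' u _ hu hkk, hK' v _ hv hkk] at h1
  rw [S.g_symm y _ u, S.g_symm y _ (S.k y), hK' u v hu hv, h.nabla_k_perp hy] at h2
  simp only [zero_mul, add_zero, mul_eq_zero, hx, false_or] at h1 h2
  rw [← hr]
  exact sub_eq_zero.2 (h1.trans h2.symm)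

/-- The Ricci tensor is aligned: `k` is orthogonal to `l` wherever `η ≠ 0`. -/
lemma g_l_k_eq_zero [FiniteDimensional ℝ E] (h : S.IsTypeN N) (hy : y ∈ S.U) (hη : S.η y ≠ 0) :
    S.g y (S.l y) (S.k y) = 0 := by
  by_contra hkl
  have hev : ∀ᶠ z in 𝓝 y, ∀ u v, S.g z (S.k z) u = 0 → S.g z (S.k z) v = 0 →
      S.g z u (S.nabla S.k z v) = 0 := by
    have c1 := (differentiableAt_η hy).continuousAt.eventually_ne hη
    have c2 := (LocalMetric.hasFDerivAt_g_apply hy (differentiableAt_l hy)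
      (differentiableAt_k hy)).1.continuousAt.eventually_ne hkl
    filter_upwards [c1, c2, S.isOpen.mem_nhds hy] with z h1 h2 h3
    exact h.nabla_k_eq_zero h3 h1 h2
  have hkl' : S.g y (S.k y) (S.l y) ≠ 0 := by rwa [S.g_symm]
  have hr := h.riem_k_eq_zero hy hkl' hev
  obtain ⟨n₀, m₀, ht₀⟩ := h.exists_tetrad y hy
  have ht := ht₀.exists_of_null (S.g_symm y) (h.k_null y hy) hkl
  obtain ⟨i, j, hne⟩ := h.exists_weyl_ne hy ht
  apply hne
  have hm : ∀ i, S.g y (S.k y) (m₀ i - ((S.g y (S.l y) (S.k y))⁻¹ * S.g y (S.k y) (m₀ i)) • S.l y)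
      = 0 := fun i => by
    simpa [hkl] using ht.n_m i
  generalize hmm : (fun i => m₀ i - ((S.g y (S.l y) (S.k y))⁻¹ * S.g y (S.k y) (m₀ i)) • S.l y) = m
    at ht hne
  replace hm : ∀ i, S.g y (S.k y) (m i) = 0 := fun i => by rw [← hmm]; exact hm i
  have hw : S.weylT N y (S.k y) (m i) (S.k y) (m j) = 0 := by
    rw [weylT_antisymm_left hy, weylT, hr _ _ (hm i) (hm j)]
    simp [phi, hm, S.g_symm y _ (S.k y), h.k_null y hy]
  rw [(isLinearMap_weylT _ _ _).map_smul, weylT_pair hy, (isLinearMap_weylT _ _ _).map_smul,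
    weylT_pair hy, congrFun hmm i, congrFun hmm j, hw, smul_zero, smul_zero]

end IsTypeN

end RadiationField

namespace RadiationField

lemma nabla₂_phi_symm {E : Type*} [NormedAddCommGroup E] [NormedSpace ℝ E] {S : RadiationField E}
    {y : E} (hy : y ∈ S.U) (e a b : E) : S.nabla₂ S.phi y e a b = S.nabla₂ S.phi y e b a := by
  rw [nabla₂_phi hy, nabla₂_phi hy]; ring

namespace IsTypeN

variable {E : Type*} [NormedAddCommGroup E] [NormedSpace ℝ E] {N : ℕ}
  {S : RadiationField E} {y : E}

/-- Wherever `η ≠ 0`, the field `k` is parallel to `l`. -/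
lemma k_eq_smul [FiniteDimensional ℝ E] (h : S.IsTypeN N) (hy : y ∈ S.U) (hη : S.η y ≠ 0)
    {n : E} {m : Fin N → E}
    (ht : IsNullTetrad (S.g y) (S.l y) n m) : S.k y = S.g y (S.k y) n • S.l y :=
  ht.eq_smul_of_null h.finrank (S.g_symm y) (h.k_null y hy)
    (by rw [S.g_symm]; exact h.g_l_k_eq_zero hy hη)

lemma phi_perp [FiniteDimensional ℝ E] (h : S.IsTypeN N) (hy : y ∈ S.U)
    (a b : E) (ha : S.g y (S.l y) a = 0) :
    S.phi y a b = 0 := by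
  by_cases hη : S.η y = 0
  · simp [phi, hη]
  · obtain ⟨n, m, ht⟩ := h.exists_tetrad y hy
    rw [phi, h.k_eq_smul hy hη ht]
    simp [ha]

lemma phi_n_n_eq_zero_iff [FiniteDimensional ℝ E] (h : S.IsTypeN N) (hy : y ∈ S.U)
    {n : E} {m : Fin N → E}
    (ht : IsNullTetrad (S.g y) (S.l y) n m) : S.phi y n n = 0 ↔ S.η y = 0 := by
  refine ⟨fun h0 => ?_, fun h0 => by simp [phi, h0]⟩
  by_contra hη
  have hk : S.g y (S.k y) n = 0 := by simpa [phi, hη] using h0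
  have := h.k_eq_smul hy hη ht
  rw [hk, zero_smul] at this
  exact h.k_ne y hy this

lemma phi_wedge [FiniteDimensional ℝ E] (h : S.IsTypeN N) (hy : y ∈ S.U) (a b c : E) :
    S.g y (S.l y) a * S.phi y b c = S.g y (S.l y) b * S.phi y a c := by
  have h1 := h.phi_perp hy (S.g y (S.l y) a • b - S.g y (S.l y) b • a) c (by simp [mul_comm])
  rw [(isLinearMap_phi c).map_sub, (isLinearMap_phi c).map_smul, (isLinearMap_phi c).map_smul] at h1
  simp only [smul_eq_mul] at h1
  linarith

lemma nabla_phi_l [FiniteDimensional ℝ E] (h : S.IsTypeN N) (hy : y ∈ S.U) (e b : E) :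
    S.nabla₂ S.phi y e (S.l y) b = 0 := by
  have h1 := (hasFDerivAt_linear_family (f := fun z a => S.phi z a b)
    (fun z => isLinearMap_phi b) (fun u => differentiableAt_phi hy u b)
    (differentiableAt_l hy)).2 e
  have h2 := fderiv_congr hy (f₁ := fun z => S.phi z (S.l z) b) (f₂ := fun _ => 0)
    fun z hz => h.phi_perp hz _ b (h.g_l_l hz)
  have h3 := h.phi_perp hy _ b (h.nabla_l_perp hy e)
  rw [LocalMetric.nabla, (isLinearMap_phi b).map_add] at h3
  rw [h2] at h1
  simp only [fderiv_fun_const, Pi.zero_apply, zero_apply] at h1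
  rw [LocalMetric.nabla₂, h.phi_perp hy _ _ (h.g_l_l hy)]
  linarith

lemma nabla_phi_wedge [FiniteDimensional ℝ E] (h : S.IsTypeN N) (hy : y ∈ S.U) (e a b c : E) :
    S.g y (S.nabla S.l y e) a * S.phi y b c + S.g y (S.l y) a * S.nabla₂ S.phi y e b c
      = S.g y (S.nabla S.l y e) b * S.phi y a c + S.g y (S.l y) b * S.nabla₂ S.phi y e a c := by
  have hg := fun x => hasFDerivAt_g_field hy (differentiableAt_l hy) x
  have hp := fun a b => (differentiableAt_phi hy a b).hasFDerivAt
  have h1 := ((hg a).1.hasFDerivAt.mul (hp b c)).fderiv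
  have h1' := ((hg b).1.hasFDerivAt.mul (hp a c)).fderiv
  have h2 := fderiv_congr hy (f₁ := fun z => S.g z (S.l z) a * S.phi z b c)
    (f₂ := fun z => S.g z (S.l z) b * S.phi z a c) fun z hz => h.phi_wedge hz a b c
  have h3 := congrArg (fun A => A e) (h1.symm.trans (h2.trans h1'))
  simp [(hg _).2] at h3
  simp only [LocalMetric.nabla₂]
  linear_combination h3 - h.phi_wedge hy (S.Γ y e a) b c - h.phi_wedge hy a (S.Γ y e b) c
    - h.phi_wedge hy a b (S.Γ y e c)

variable {n : E} {m : Fin N → E}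

lemma nabla_phi_m_m [FiniteDimensional ℝ E] (h : S.IsTypeN N) (hy : y ∈ S.U)
    (ht : IsNullTetrad (S.g y) (S.l y) n m)
    (e : E) (i j : Fin N) : S.nabla₂ S.phi y e (m i) (m j) = 0 := by
  have := h.nabla_phi_wedge hy e n (m i) (m j)
  simpa [ht.l_n, ht.l_m, phi_symm _ (m j), h.phi_perp hy (m j) _ (ht.l_m j)] using this

lemma nabla_phi_m_n [FiniteDimensional ℝ E] (h : S.IsTypeN N) (hy : y ∈ S.U)
    (ht : IsNullTetrad (S.g y) (S.l y) n m)
    (e : E) (i : Fin N) : S.nabla₂ S.phi y e (m i) n =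
      S.g y (S.nabla S.l y e) (m i) * S.phi y n n := by
  have := h.nabla_phi_wedge hy e n (m i) n
  simpa [ht.l_n, ht.l_m, h.phi_perp hy (m i) _ (ht.l_m i)] using this

lemma nabla_weyl_l_n [FiniteDimensional ℝ E] (h : S.IsTypeN N) (hy : y ∈ S.U)
    (ht : IsNullTetrad (S.g y) (S.l y) n m)
    (e c f : E) : S.nabla₄ (S.weylT N) y e (S.l y) n c f =
      ∑ k, S.g y (S.nabla S.l y e) (m k) * S.weylT N y n (m k) c f := by
  have hnn : S.weylT N y n n c f = 0 := by
    linarith [weylT_antisymm_left (N := N) hy n n c f]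
  rw [h.nabla_weyl_l hy, ht.apply_eq h.finrank (S.g_symm y) (isLinearMap_weylT n c f)]
  simp only [h.weyl_l y hy, hnn, smul_zero, zero_add, ← Finset.sum_neg_distrib]
  refine Finset.sum_congr rfl fun k _ => ?_
  rw [weylT_antisymm_left hy, smul_eq_mul]; ring

lemma nabla_weyl_m_m (h : S.IsTypeN N) (hy : y ∈ S.U) (ht : IsNullTetrad (S.g y) (S.l y) n m)
    (e c f : E) (i j : Fin N) : S.nabla₄ (S.weylT N) y e (m i) (m j) c f =
      S.g y (S.nabla S.l y e) (m i) * S.weylT N y n (m j) c f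
      - S.g y (S.nabla S.l y e) (m j) * S.weylT N y n (m i) c f := by
  have := h.nabla_weyl_wedge hy e n (m i) (m j) c f
  rw [h.weyl_perp y hy _ _ c f (ht.l_m i) (ht.l_m j), weylT_antisymm_left hy (m j) n, ht.l_n,
    ht.l_m, ht.l_m] at this
  linarith

lemma weyl_l_three (h : S.IsTypeN N) (hy : y ∈ S.U) (a b f : E) :
    S.weylT N y a b (S.l y) f = 0 := by
  rw [weylT_pair hy, h.weyl_l y hy]

lemma weyl_l_four (h : S.IsTypeN N) (hy : y ∈ S.U) (a b c : E) :
    S.weylT N y a b c (S.l y) = 0 := by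
  rw [weylT_antisymm_right, h.weyl_l_three hy, neg_zero]

lemma kappa_wedge [FiniteDimensional ℝ E] (h : S.IsTypeN N) (hy : y ∈ S.U)
    (ht : IsNullTetrad (S.g y) (S.l y) n m)
    (i j k : Fin N) :
    S.g y (S.nabla S.l y (S.l y)) (m i) *
      (S.weylT N y n (m j) n (m k) + if j = k then (N : ℝ)⁻¹ * S.phi y n n else 0)
    = S.g y (S.nabla S.l y (S.l y)) (m j) *
      (S.weylT N y n (m i) n (m k) + if i = k then (N : ℝ)⁻¹ * S.phi y n n else 0) := by
  have hB := weylT_bianchi (N := N) hy (S.l y) (m i) (m j) n (m k)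
  have hml : ∀ i, S.g y (m i) (S.l y) = 0 := fun i => by rw [S.g_symm, ht.l_m]
  have hnl : S.g y n (S.l y) = 1 := by rw [S.g_symm, ht.l_n]
  have h1 : S.nabla₄ (S.weylT N) y (m i) n (m k) (m j) (S.l y) = 0 := by
    rw [nabla₄_weylT_antisymm_right hy, nabla₄_weylT_pair hy, h.nabla_weyl_l_perp hy _ _ _ _
      (ht.l_m j), neg_zero]
  have h2 : S.nabla₄ (S.weylT N) y (m j) n (m k) (S.l y) (m i) = 0 := by
    rw [nabla₄_weylT_pair hy, h.nabla_weyl_l_perp hy _ _ _ _ (ht.l_m i)]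
  rw [nabla₄_weylT_pair hy, h.nabla_weyl_m_m hy ht, h1, h2] at hB
  simp [ht.n_m, hml, hnl, ht.m_m, h.nabla_phi_m_m hy ht, h.nabla_phi_l hy,
    h.nabla_phi_m_n hy ht, eq_comm (a := k)] at hB
  split_ifs at hB ⊢ <;> linear_combination hB

lemma kappa_contract [FiniteDimensional ℝ E] (h : S.IsTypeN N) (hy : y ∈ S.U)
    (ht : IsNullTetrad (S.g y) (S.l y) n m)
    (i : Fin N) :
    ∑ k, S.g y (S.nabla S.l y (S.l y)) (m k) *
      (S.weylT N y n (m k) n (m i) + if k = i then (N : ℝ)⁻¹ * S.phi y n n else 0) = 0 := by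
  have hB := weylT_bianchi (N := N) hy (S.l y) (m i) n (S.l y) n
  have hnl : S.g y n (S.l y) = 1 := by rw [S.g_symm, ht.l_n]
  have hPl : S.nabla₂ S.phi y n (m i) (S.l y) = 0 := by
    rw [nabla₂_phi_symm hy, h.nabla_phi_l hy]
  rw [h.nabla_weyl_l_n hy ht, h.nabla_weyl_l_n hy ht, h.nabla_weyl_l_n hy ht] at hB
  simp [ht.n_m, ht.n_n, ht.l_l, ht.l_m, ht.l_n, hnl, h.nabla_phi_l hy,
    nabla₂_phi_symm hy _ n, h.nabla_phi_m_n hy ht, h.weyl_l_three hy, h.weyl_l_four hy,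
    weylT_antisymm_right _ _ (m i) n] at hB
  rw [hPl] at hB
  simp only [mul_add, Finset.sum_add_distrib, mul_ite, mul_zero, Finset.sum_ite_eq',
    Finset.mem_univ, if_true]
  linear_combination -hB

/-- A multiple WAND of a spacetime of type N is geodetic. -/
lemma geodetic [FiniteDimensional ℝ E] (h : S.IsTypeN N) (hy : y ∈ S.U)
    (ht : IsNullTetrad (S.g y) (S.l y) n m)
    (i : Fin N) : S.g y (S.nabla S.l y (S.l y)) (m i) = 0 := by
  by_contra hi
  obtain ⟨p, q, hne⟩ := h.exists_weyl_ne hy ht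
  have hN : (N : ℝ) ≠ 0 := by have := h.two_le; positivity
  set κ : Fin N → ℝ := fun i => S.g y (S.nabla S.l y (S.l y)) (m i)
  have hQ : ∀ j k, S.weylT N y n (m j) n (m k)
      + (if j = k then (N : ℝ)⁻¹ * S.phi y n n else 0) = 0 := by
    intro j k
    have h1 : (∑ i, κ i * κ i) * (S.weylT N y n (m j) n (m k)
      + (if j = k then (N : ℝ)⁻¹ * S.phi y n n else 0)) = 0 := by
      have := h.kappa_contract hy ht k
      calc _ = κ j * ∑ i, κ i * (S.weylT N y n (m i) n (m k)
              + if i = k then (N : ℝ)⁻¹ * S.phi y n n else 0) := by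
            rw [Finset.sum_mul, Finset.mul_sum]
            refine Finset.sum_congr rfl fun i _ => ?_
            rw [mul_assoc, h.kappa_wedge hy ht i j k]; ring
        _ = 0 := by rw [this, mul_zero]
    refine (mul_eq_zero.1 h1).resolve_left fun h0 => hi ?_
    have := (Finset.sum_eq_zero_iff_of_nonneg (fun i _ => mul_self_nonneg (κ i))).1 h0 i
      (Finset.mem_univ i)
    simpa using this
  have htr := h.weyl_trace y hy n m ht
  have hφ : S.phi y n n = 0 := by
    have h1 : ∀ i, S.weylT N y n (m i) n (m i) = - ((N : ℝ)⁻¹ * S.phi y n n) := fun i => by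
      have := hQ i i
      simp only [if_true] at this
      linarith
    simp only [h1, Finset.sum_const, Finset.card_univ, Fintype.card_fin, nsmul_eq_mul] at htr
    field_simp at htr
    linarith
  apply hne
  have := hQ p q
  simpa [hφ] using this

lemma rho_commute [FiniteDimensional ℝ E] (h : S.IsTypeN N) (hy : y ∈ S.U)
    (ht : IsNullTetrad (S.g y) (S.l y) n m)
    (hs : ∀ i j, S.g y (S.nabla S.l y (m i)) (m j) = S.g y (S.nabla S.l y (m j)) (m i))
    (i j : Fin N) :
    ∑ k, S.g y (S.nabla S.l y (m i)) (m k) * S.weylT N y n (m k) n (m j)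
      = ∑ k, S.g y (S.nabla S.l y (m j)) (m k) * S.weylT N y n (m k) n (m i) := by
  have hB := weylT_bianchi (N := N) hy (m i) (m j) n (S.l y) n
  have hmm : ∀ k, S.weylT N y n (m k) (m i) (m j) = 0 := fun k => by
    rw [weylT_pair hy, h.weyl_perp y hy _ _ _ _ (ht.l_m i) (ht.l_m j)]
  rw [h.nabla_weyl_l_n hy ht, h.nabla_weyl_l_n hy ht, h.nabla_weyl_l_n hy ht] at hB
  simp [ht.n_m, ht.n_n, ht.l_m, ht.l_n, h.nabla_phi_l hy,
    nabla₂_phi_symm hy _ n, h.nabla_phi_m_n hy ht, hmm, hs i j,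
    weylT_antisymm_right _ _ (m j) n] at hB
  linear_combination -hB

lemma rho_wedge [FiniteDimensional ℝ E] (h : S.IsTypeN N) (hy : y ∈ S.U)
    (ht : IsNullTetrad (S.g y) (S.l y) n m)
    (i j p q : Fin N) :
    S.g y (S.nabla S.l y (m i)) (m p) *
        (S.weylT N y n (m q) n (m j) + if q = j then (N : ℝ)⁻¹ * S.phi y n n else 0)
      - S.g y (S.nabla S.l y (m i)) (m q) *
        (S.weylT N y n (m p) n (m j) + if p = j then (N : ℝ)⁻¹ * S.phi y n n else 0)
      - S.g y (S.nabla S.l y (m j)) (m p) *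
        (S.weylT N y n (m q) n (m i) + if q = i then (N : ℝ)⁻¹ * S.phi y n n else 0)
      + S.g y (S.nabla S.l y (m j)) (m q) *
        (S.weylT N y n (m p) n (m i) + if p = i then (N : ℝ)⁻¹ * S.phi y n n else 0) = 0 := by
  have hB := weylT_bianchi (N := N) hy (m i) (m j) n (m p) (m q)
  have hmn : ∀ i, S.g y (m i) n = 0 := fun i => by rw [S.g_symm, ht.n_m]
  have hmm : ∀ k, S.weylT N y n (m k) (m i) (m j) = 0 := fun k => by
    rw [weylT_pair hy, h.weyl_perp y hy _ _ _ _ (ht.l_m i) (ht.l_m j)]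
  rw [h.nabla_weyl_m_m hy ht, h.nabla_weyl_m_m hy ht, h.nabla_weyl_m_m hy ht,
    weylT_antisymm_right _ _ (m j) n, weylT_antisymm_right _ _ (m j) n, hmm, hmm] at hB
  simp [hmn, ht.m_m, h.nabla_phi_m_m hy ht,
    nabla₂_phi_symm hy _ n, h.nabla_phi_m_n hy ht] at hB
  split_ifs at hB ⊢ <;> linear_combination -hB

end IsTypeN

end RadiationField

section Matrices

open Matrix

variable {N : ℕ}

/-- Solutions of `r ∧ Q = 0` for a diagonal matrix `r` commuting with `Q`. -/
lemma diagonal_wedge_eq_zero (hN : 2 ≤ N) {r : Fin N → ℝ} {Q : Matrix (Fin N) (Fin N) ℝ}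
    (hQ : Q ≠ 0) (hcomm : ∀ i j, r i * Q i j = r j * Q i j)
    (hw : ∀ i j p q, diagonal r i p * Q q j - diagonal r i q * Q p j - diagonal r j p * Q q i
      + diagonal r j q * Q p i = 0) :
    r = 0 ∨ ∃ i j, i ≠ j ∧ r i ≠ 0 ∧ (∀ k, k ≠ i → k ≠ j → r k = 0) ∧
      (r j = r i ↔ Q.trace = 0) := by
  have w1 : ∀ i j, i ≠ j → r i * Q j j + r j * Q i i = 0 := by
    intro i j hij
    simpa [diagonal_apply, hij, hij.symm] using hw i j i j
  have w2 : ∀ i p q, i ≠ p → i ≠ q → p ≠ q → r i * Q p q = 0 := by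
    intro i p q hp hq hpq
    simpa [diagonal_apply, hp, hq, hp.symm, hq.symm, hpq.symm] using hw i q i p
  by_cases hr : r = 0
  · exact Or.inl hr
  right
  obtain ⟨i, hi⟩ : ∃ i, r i ≠ 0 := by
    by_contra! h0
    exact hr (funext h0)
  by_cases hQi : Q i i = 0
  · have hd : ∀ j, Q j j = 0 := by
      intro j
      by_cases hij : i = j
      · rw [← hij, hQi]
      · simpa [hQi, hi] using w1 i j hij
    have htr : Q.trace = 0 := by simp [Matrix.trace, hd]
    obtain ⟨p, q, hpq⟩ : ∃ p q, Q p q ≠ 0 := by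
      by_contra! h0
      exact hQ (Matrix.ext h0)
    have hne : p ≠ q := by rintro rfl; exact hpq (hd p)
    have hrpq : r p = r q := mul_right_cancel₀ hpq (hcomm p q)
    have hz : ∀ k, k ≠ p → k ≠ q → r k = 0 := fun k hp hq => by
      simpa [hpq] using w2 k p q hp hq hne
    refine ⟨p, q, hne, fun hp0 => ?_, hz, by simp [hrpq, htr]⟩
    by_cases hip : i = p
    · exact hi (hip ▸ hp0)
    by_cases hiq : i = q
    · exact hi (hiq ▸ (hrpq ▸ hp0))
    · exact hi (hz i hip hiq)
  · have hd : ∀ j, j ≠ i → Q j j = - r j / r i * Q i i := by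
      intro j hj
      have := w1 i j hj.symm
      field_simp
      linarith
    have hprod : ∀ j k, j ≠ i → k ≠ i → j ≠ k → r j * r k = 0 := by
      intro j k hj hk hjk
      have h1 := w1 j k hjk
      rw [hd j hj, hd k hk] at h1
      field_simp at h1
      simpa [hQi] using h1
    obtain ⟨j, hji, hj⟩ : ∃ j, j ≠ i ∧ ∀ k, k ≠ i → k ≠ j → r k = 0 := by
      by_cases hex : ∃ j, j ≠ i ∧ r j ≠ 0
      · obtain ⟨j, hj, hrj⟩ := hex
        exact ⟨j, hj, fun k hk hkj => (mul_eq_zero.1 (hprod k j hk hj hkj)).resolve_right hrj⟩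
      · push Not at hex
        have : Nontrivial (Fin N) := Fin.nontrivial_iff_two_le.2 hN
        obtain ⟨j, hj⟩ := exists_ne i
        exact ⟨j, hj, fun k hk _ => hex k hk⟩
    refine ⟨i, j, hji.symm, hi, hj, ?_⟩
    have htr : Q.trace = Q i i + Q j j := by
      rw [Matrix.trace, ← Finset.sum_subset (Finset.subset_univ {i, j}), Finset.sum_pair hji.symm]
      · simp
      · intro k _ hk
        simp only [Finset.mem_insert, Finset.mem_singleton, not_or] at hk
        simp [hd k hk.1, hj k hk.1 hk.2]
    have htr' : Q.trace * r i = Q i i * (r i - r j) := by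
      rw [htr, hd j hji]; field_simp
      ring
    constructor
    · intro h
      rw [h, sub_self, mul_zero] at htr'
      exact (mul_eq_zero.1 htr').resolve_right hi
    · intro h
      rw [h, zero_mul] at htr'
      have := (mul_eq_zero.1 htr'.symm).resolve_left hQi
      linarith

/-- A real symmetric matrix is diagonalised by an orthogonal matrix. -/
lemma exists_orthogonal_diagonal {A : Matrix (Fin N) (Fin N) ℝ} (hA : Aᵀ = A) :
    ∃ (X : Matrix (Fin N) (Fin N) ℝ) (r : Fin N → ℝ), X * Xᵀ = 1 ∧ X * A * Xᵀ = diagonal r := by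
  have hH : A.IsHermitian := by
    rw [Matrix.IsHermitian, conjTranspose_eq_transpose_of_trivial, hA]
  set V : Matrix (Fin N) (Fin N) ℝ := hH.eigenvectorUnitary.1
  have hV : Vᵀ * V = 1 := by
    have := (Matrix.mem_unitaryGroup_iff'.1 hH.eigenvectorUnitary.2)
    rwa [star_eq_conjTranspose, conjTranspose_eq_transpose_of_trivial] at this
  refine ⟨Vᵀ, hH.eigenvalues, by simpa using hV, ?_⟩
  have h := hH.spectral_theorem
  rw [Unitary.conjStarAlgAut_apply] at h
  rw [star_eq_conjTranspose, conjTranspose_eq_transpose_of_trivial] at h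
  conv_lhs => rw [h]
  rw [transpose_transpose]
  change Vᵀ * (V * _ * Vᵀ) * V = _
  calc _ = (Vᵀ * V) * diagonal (RCLike.ofReal ∘ hH.eigenvalues) * (Vᵀ * V) := by
        simp only [Matrix.mul_assoc]
    _ = _ := by rw [hV]; simp

lemma exists_perm_apply_eq {i j a b : Fin N} (hij : i ≠ j) (hab : a ≠ b) :
    ∃ σ : Equiv.Perm (Fin N), σ a = i ∧ σ b = j := by
  refine ⟨Equiv.swap (Equiv.swap a i b) j * Equiv.swap a i, ?_, ?_⟩
  · simp only [Equiv.Perm.mul_apply, Equiv.swap_apply_left]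
    apply Equiv.swap_apply_of_ne_of_ne _ hij
    intro h
    have : Equiv.swap a i a = Equiv.swap a i b := by rw [Equiv.swap_apply_left]; exact h
    exact hab ((Equiv.swap a i).injective this)
  · simp

/-- The diagonalising matrix can be chosen special orthogonal, with any order of the diagonal. -/
lemma exists_specialOrthogonal_diagonal (hN : 0 < N) {A X : Matrix (Fin N) (Fin N) ℝ}
    {r : Fin N → ℝ} (hX : X * Xᵀ = 1) (hA : X * A * Xᵀ = diagonal r) (σ : Equiv.Perm (Fin N)) :
    ∃ Y ∈ specialOrthogonalGroup (Fin N) ℝ, Y * A * Yᵀ = diagonal (r ∘ σ) := by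
  set Z := X.submatrix σ id with hZ
  have hZZ : Z * Zᵀ = 1 := by
    rw [hZ, transpose_submatrix, ← submatrix_mul X Xᵀ σ id σ Function.bijective_id, hX,
      submatrix_one_equiv]
  have hZA : Z * A * Zᵀ = diagonal (r ∘ σ) := by
    have h1 : Z * A = (X * A).submatrix σ id := by
      ext i j; simp [hZ, Matrix.mul_apply]
    rw [h1, hZ, transpose_submatrix, ← submatrix_mul (X * A) Xᵀ σ id σ Function.bijective_id, hA,
      submatrix_diagonal_equiv]
  have hdet : Z.det * Z.det = 1 := by
    have := congrArg Matrix.det hZZ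
    simpa using this
  set ε : Fin N → ℝ := Function.update 1 ⟨0, hN⟩ Z.det with hε
  have hεε : ∀ i, ε i * ε i = 1 := by
    intro i
    by_cases hi : i = ⟨0, hN⟩
    · simp [hε, hi, hdet]
    · simp [hε, hi]
  refine ⟨diagonal ε * Z, ?_, ?_⟩
  · rw [mem_specialOrthogonalGroup_iff, mem_orthogonalGroup_iff]
    refine ⟨?_, ?_⟩
    · rw [transpose_mul, diagonal_transpose, Matrix.mul_assoc, ← Matrix.mul_assoc Z, hZZ,
        Matrix.one_mul,
        diagonal_mul_diagonal]
      simp [hεε]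
    · rw [det_mul, det_diagonal, hε, Finset.prod_update_of_mem (Finset.mem_univ _)]
      simpa using hdet
  · rw [transpose_mul, diagonal_transpose]
    calc _ = diagonal ε * (Z * A * Zᵀ) * diagonal ε := by simp only [Matrix.mul_assoc]
      _ = _ := by
        rw [hZA, diagonal_mul_diagonal, diagonal_mul_diagonal]
        congr 1
        funext i
        linear_combination (r ∘ σ) i * hεε i

lemma opticalConstraint_conj {A Y : Matrix (Fin N) (Fin N) ℝ}
    (hY : Y * Yᵀ = 1) : OpticalConstraint (Y * A * Yᵀ) ↔ OpticalConstraint A := by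
  have hY' : Yᵀ * Y = 1 := mul_eq_one_comm.1 hY
  have h1 : (Y * A * Yᵀ) * (Y * A * Yᵀ)ᵀ = Y * (A * Aᵀ) * Yᵀ := by
    rw [transpose_mul, transpose_mul, transpose_transpose]
    calc _ = Y * A * (Yᵀ * Y) * Aᵀ * Yᵀ := by simp only [Matrix.mul_assoc]
      _ = _ := by rw [hY']; simp only [Matrix.mul_assoc, Matrix.mul_one]
  have h2 : symPart (Y * A * Yᵀ) = Y * symPart A * Yᵀ := by
    rw [symPart, symPart, transpose_mul, transpose_mul, transpose_transpose]
    simp only [Matrix.mul_smul, Matrix.smul_mul, Matrix.mul_add, Matrix.add_mul, Matrix.mul_assoc]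
  have hinj : ∀ P Q : Matrix (Fin N) (Fin N) ℝ, Y * P * Yᵀ = Y * Q * Yᵀ → P = Q := by
    intro P Q h
    have h3 : ∀ P, Yᵀ * (Y * P * Yᵀ) * Y = P := fun P => by
      calc _ = (Yᵀ * Y) * P * (Yᵀ * Y) := by simp only [Matrix.mul_assoc]
        _ = P := by rw [hY', Matrix.one_mul, Matrix.mul_one]
    rw [← h3 P, h, h3]
  unfold OpticalConstraint
  refine exists_congr fun c => ?_
  rw [h1, h2, ← Matrix.smul_mul, ← Matrix.mul_smul]
  exact ⟨hinj _ _, fun h => by rw [h]⟩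

lemma opticalConstraint_canonicalForm (hN : 2 ≤ N) (s b : ℝ) :
    OpticalConstraint (canonicalForm N s b) ↔ s = 0 ∨ b = 0 ∨ b = 1 := by
  have hsym : symPart (canonicalForm N s b) = canonicalForm N s b := by
    rw [symPart, canonicalForm, transpose_smul, diagonal_transpose, ← two_smul ℝ, smul_smul]
    norm_num
  have hT : (canonicalForm N s b)ᵀ = canonicalForm N s b := by
    rw [canonicalForm, transpose_smul, diagonal_transpose]
  unfold OpticalConstraint
  rw [hsym, hT]
  simp only [canonicalForm, diagonal_mul_diagonal,
    ← diagonal_smul, smul_smul]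
  constructor
  · rintro ⟨c, hc⟩
    have h0 := congrArg (fun A => A ⟨0, by omega⟩ ⟨0, by omega⟩) hc
    have h1 := congrArg (fun A => A ⟨1, by omega⟩ ⟨1, by omega⟩) hc
    simp at h0 h1
    by_cases hs : s = 0
    · exact Or.inl hs
    · right
      have hc : c = s := by
        rcases h0 with h0 | h0
        · exact h0.symm
        · exact absurd h0 hs
      subst hc
      have h2 : b * (b - 1) = 0 := by
        have : (c * c) * (b * (b - 1)) = 0 := by linear_combination h1
        simpa [hs] using this
      rcases mul_eq_zero.1 h2 with h | h
      · exact Or.inl h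
      · exact Or.inr (by linarith)
  · intro h
    refine ⟨s, ?_⟩
    congr 1
    funext i
    rcases h with rfl | rfl | rfl
    · simp
    · by_cases h0 : (i : ℕ) = 0 <;> simp [h0]
    · by_cases h0 : (i : ℕ) = 0 <;> by_cases h1 : (i : ℕ) = 1 <;> simp [h0, h1]

lemma expansion_shear_twist_eq_zero_iff (A : Matrix (Fin N) (Fin N) ℝ) :
    (expansion A = 0 ∧ shearSq A = 0 ∧ twistSq A = 0) ↔ A = 0 := by
  constructor
  · rintro ⟨h1, h2, h3⟩
    ext i j
    simp only [shearSq, twistSq, h1, ite_self, sub_zero] at h2 h3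
    have hz : ∀ B : Matrix (Fin N) (Fin N) ℝ, ∑ i, ∑ j, B i j ^ 2 = 0 → B i j = 0 := by
      intro B hB
      have := (Finset.sum_eq_zero_iff_of_nonneg
        (fun i _ => Finset.sum_nonneg fun j _ => sq_nonneg (B i j))).1 hB i (Finset.mem_univ i)
      have := (Finset.sum_eq_zero_iff_of_nonneg (fun j _ => sq_nonneg (B i j))).1 this j
        (Finset.mem_univ j)
      simpa using this
    have h4 := hz _ h2
    have h5 := hz _ h3
    simp [symPart, skewPart] at h4 h5
    simp only [Matrix.zero_apply]
    linarith
  · rintro rfl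
    simp [expansion, shearSq, twistSq, symPart, skewPart]

end Matrices

section CoordinateMetric

variable {d : ℕ}

/-- The coordinate space. -/
abbrev Coord (d : ℕ) : Type := EuclideanSpace ℝ (Fin d)

/-- The form with components `G`. -/
def coordForm (G : Coord d → Matrix (Fin d) (Fin d) ℝ) (y : Coord d) :
    Coord d →L[ℝ] Coord d →L[ℝ] ℝ :=
  ∑ a, ∑ b, G y a b • (EuclideanSpace.proj a : Coord d →L[ℝ] ℝ).smulRight
    (EuclideanSpace.proj b : Coord d →L[ℝ] ℝ)

/-- The Christoffel symbols as a bilinear map. -/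
def coordConn (G : Coord d → Matrix (Fin d) (Fin d) ℝ) (y : Coord d) :
    Coord d →L[ℝ] Coord d →L[ℝ] Coord d :=
  ∑ a, ∑ b, ∑ c, christoffel G a b c y • (EuclideanSpace.proj b : Coord d →L[ℝ] ℝ).smulRight
    ((EuclideanSpace.proj c : Coord d →L[ℝ] ℝ).smulRight (EuclideanSpace.single a (1 : ℝ)))

lemma coordForm_apply (G : Coord d → Matrix (Fin d) (Fin d) ℝ) (y u v : Coord d) :
    coordForm G y u v = ∑ a, ∑ b, G y a b * (u a * v b) := by
  simp [coordForm]

lemma coordConn_apply (G : Coord d → Matrix (Fin d) (Fin d) ℝ) (y u v : Coord d) (a : Fin d) :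
    coordConn G y u v a = ∑ b, ∑ c, christoffel G a b c y * (u b * v c) := by
  simp [coordConn, Finset.sum_apply, Pi.single_apply]

lemma coordForm_single (G : Coord d → Matrix (Fin d) (Fin d) ℝ) (y : Coord d) (a b : Fin d) :
    coordForm G y (EuclideanSpace.single a 1) (EuclideanSpace.single b 1) = G y a b := by
  simp [coordForm_apply]

lemma coordConn_single (G : Coord d → Matrix (Fin d) (Fin d) ℝ) (y : Coord d) (a b c : Fin d) :
    coordConn G y (EuclideanSpace.single b 1) (EuclideanSpace.single c 1) a =
      christoffel G a b c y := by
  simp [coordConn_apply]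

lemma sum_smul_single (u : Coord d) : u = ∑ a, u a • (EuclideanSpace.single a 1 : Coord d) := by
  ext i
  simp [Pi.single_apply]

lemma IsLinearMap.apply_eq_sum {F : Type*} [AddCommGroup F] [Module ℝ F] {f : Coord d → F}
    (hf : IsLinearMap ℝ f) (u : Coord d) :
    f u = ∑ a, u a • f (EuclideanSpace.single a 1) := by
  have := congrArg (hf.mk' f) (sum_smul_single u)
  simpa only [map_sum, map_smul, IsLinearMap.mk'_apply] using this

lemma IsLinearMap.ext_single {F : Type*} [AddCommGroup F] [Module ℝ F] {f g : Coord d → F}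
    (hf : IsLinearMap ℝ f) (hg : IsLinearMap ℝ g)
    (h : ∀ a, f (EuclideanSpace.single a 1) = g (EuclideanSpace.single a 1)) (u : Coord d) :
    f u = g u := by
  rw [IsLinearMap.apply_eq_sum hf, IsLinearMap.apply_eq_sum hg]
  simp only [h]

variable {U : Set (Coord d)} {G : Coord d → Matrix (Fin d) (Fin d) ℝ}

lemma contDiffOn_det {n : ℕ} {A : Coord d → Matrix (Fin n) (Fin n) ℝ}
    (hA : ∀ i j, ContDiffOn ℝ ∞ (fun y => A y i j) U) : ContDiffOn ℝ ∞ (fun y => (A y).det) U := by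
  simp only [Matrix.det_apply]
  exact ContDiffOn.sum fun σ _ => (contDiffOn_prod fun i _ => hA _ _).const_smul _

lemma contDiffOn_inv (hG : ∀ a b, ContDiffOn ℝ ∞ (fun y => G y a b) U)
    (hdet : ∀ y ∈ U, (G y).det ≠ 0) (a b : Fin d) :
    ContDiffOn ℝ ∞ (fun y => (G y)⁻¹ a b) U := by
  have h1 : ∀ y, (G y)⁻¹ a b = ((G y).det)⁻¹ * ((G y).updateRow b (Pi.single a 1)).det := by
    intro y
    rw [Matrix.inv_def, Matrix.smul_apply, Matrix.adjugate_apply, Ring.inverse_eq_inv', smul_eq_mul]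
  simp only [h1]
  refine ((contDiffOn_det hG).inv hdet).mul (contDiffOn_det fun i j => ?_)
  by_cases hi : i = b
  · subst hi
    simp only [Matrix.updateRow_self]
    exact contDiffOn_const
  · simp only [Matrix.updateRow_ne hi]
    exact hG i j

lemma contDiffOn_partialDeriv (hU : IsOpen U) {f : Coord d → ℝ} (hf : ContDiffOn ℝ ∞ f U)
    (a : Fin d) :
    ContDiffOn ℝ ∞ (partialDeriv a f) U :=
  (hf.fderiv_of_isOpen hU (m := ∞) le_rfl).clm_apply contDiffOn_const

lemma contDiffOn_christoffel (hU : IsOpen U) (hG : ∀ a b, ContDiffOn ℝ ∞ (fun y => G y a b) U)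
    (hdet : ∀ y ∈ U, (G y).det ≠ 0) (a b c : Fin d) :
    ContDiffOn ℝ ∞ (christoffel G a b c) U := by
  have h := fun a b c => contDiffOn_partialDeriv hU (hG b c) a
  unfold christoffel
  exact contDiffOn_const.mul (ContDiffOn.sum fun e _ =>
    (contDiffOn_inv hG hdet a e).mul (((h b e c).add (h c e b)).sub (h e b c)))

lemma contDiffOn_coordForm (hG : ∀ a b, ContDiffOn ℝ ∞ (fun y => G y a b) U) :
    ContDiffOn ℝ ∞ (coordForm G) U := by
  unfold coordForm
  exact ContDiffOn.sum fun a _ => ContDiffOn.sum fun b _ => (hG a b).smul contDiffOn_const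

lemma contDiffOn_coordConn (hU : IsOpen U) (hG : ∀ a b, ContDiffOn ℝ ∞ (fun y => G y a b) U)
    (hdet : ∀ y ∈ U, (G y).det ≠ 0) : ContDiffOn ℝ ∞ (coordConn G) U := by
  unfold coordConn
  exact ContDiffOn.sum fun a _ => ContDiffOn.sum fun b _ => ContDiffOn.sum fun c _ =>
    (contDiffOn_christoffel hU hG hdet a b c).smul contDiffOn_const

lemma fderiv_coordForm (hU : IsOpen U) (hG : ∀ a b, ContDiffOn ℝ ∞ (fun y => G y a b) U)
    {y : Coord d} (hy : y ∈ U) (a b c : Fin d) :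
    fderiv ℝ (coordForm G) y (EuclideanSpace.single c 1) (EuclideanSpace.single a 1)
      (EuclideanSpace.single b 1) = partialDeriv c (fun z => G z a b) y := by
  have h1 : DifferentiableAt ℝ (coordForm G) y :=
    ((contDiffOn_coordForm hG).contDiffAt (hU.mem_nhds hy)).differentiableAt (by simp)
  have h2 := (h1.hasFDerivAt.clm_apply
    (hasFDerivAt_const (EuclideanSpace.single a (1 : ℝ)) y)).clm_apply
    (hasFDerivAt_const (EuclideanSpace.single b (1 : ℝ)) y)
  simp only [coordForm_single] at h2
  rw [partialDeriv, h2.fderiv]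
  simp

lemma fderiv_coordConn (hU : IsOpen U) (hG : ∀ a b, ContDiffOn ℝ ∞ (fun y => G y a b) U)
    (hdet : ∀ y ∈ U, (G y).det ≠ 0) {y : Coord d} (hy : y ∈ U) (a b c e : Fin d) :
    fderiv ℝ (coordConn G) y (EuclideanSpace.single e 1) (EuclideanSpace.single b 1)
      (EuclideanSpace.single c 1) a = partialDeriv e (christoffel G a b c) y := by
  have h1 : DifferentiableAt ℝ (coordConn G) y :=
    ((contDiffOn_coordConn hU hG hdet).contDiffAt (hU.mem_nhds hy)).differentiableAt (by simp)
  have h2 := (h1.hasFDerivAt.clm_apply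
    (hasFDerivAt_const (EuclideanSpace.single b (1 : ℝ)) y)).clm_apply
    (hasFDerivAt_const (EuclideanSpace.single c (1 : ℝ)) y)
  have h3 := (EuclideanSpace.proj a : Coord d →L[ℝ] ℝ).hasFDerivAt.comp y h2
  have h4 : ⇑(EuclideanSpace.proj a : Coord d →L[ℝ] ℝ) ∘ (fun z => coordConn G z
      (EuclideanSpace.single b 1) (EuclideanSpace.single c 1)) = christoffel G a b c := by
    funext z
    simp [coordConn_single]
  rw [h4] at h3
  rw [partialDeriv, h3.fderiv]
  simp

lemma coordForm_symm (hs : ∀ y a b, G y a b = G y b a) (y u v : Coord d) :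
    coordForm G y u v = coordForm G y v u := by
  rw [coordForm_apply, coordForm_apply, Finset.sum_comm]
  refine Finset.sum_congr rfl fun a _ => Finset.sum_congr rfl fun b _ => ?_
  rw [hs y b a]; ring

lemma christoffel_symm (hs : ∀ y a b, G y a b = G y b a) (a b c : Fin d) (y : Coord d) :
    christoffel G a b c y = christoffel G a c b y := by
  unfold christoffel
  congr 1
  refine Finset.sum_congr rfl fun e _ => ?_
  simp only [hs _ b c]
  ring

lemma coordConn_symm (hs : ∀ y a b, G y a b = G y b a) (y u v : Coord d) :
    coordConn G y u v = coordConn G y v u := by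
  ext a
  rw [coordConn_apply, coordConn_apply, Finset.sum_comm]
  refine Finset.sum_congr rfl fun b _ => Finset.sum_congr rfl fun c _ => ?_
  rw [christoffel_symm hs a c b]; ring

/-- The Koszul formula in components. -/
lemma sum_mul_christoffel {y : Coord d} (hdet : (G y).det ≠ 0) (f b c : Fin d) :
    ∑ a, G y f a * christoffel G a b c y = (1 / 2 : ℝ) * (partialDeriv b (fun z => G z f c) y
      + partialDeriv c (fun z => G z f b) y - partialDeriv f (fun z => G z b c) y) := by
  have h1 : ∀ e, ∑ a, G y f a * (G y)⁻¹ a e = if f = e then 1 else 0 := by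
    intro e
    rw [← Matrix.mul_apply, Matrix.mul_nonsing_inv _ (isUnit_iff_ne_zero.2 hdet), Matrix.one_apply]
  unfold christoffel
  simp only [Finset.mul_sum]
  rw [Finset.sum_comm]
  have h2 : ∀ e a, ∀ x : ℝ, G y f a * (1 / 2 * ((G y)⁻¹ a e * x)) =
      (G y f a * (G y)⁻¹ a e) * (1 / 2 * x) := by intros; ring
  simp only [h2, ← Finset.sum_mul, h1]
  simp

lemma coordForm_coordConn_single {y : Coord d} (hdet : (G y).det ≠ 0) (f b c : Fin d) :
    coordForm G y (EuclideanSpace.single f 1)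
      (coordConn G y (EuclideanSpace.single b 1) (EuclideanSpace.single c 1)) =
    (1 / 2 : ℝ) * (partialDeriv b (fun z => G z f c) y
      + partialDeriv c (fun z => G z f b) y - partialDeriv f (fun z => G z b c) y) := by
  rw [← sum_mul_christoffel hdet]
  simp only [coordForm_apply, coordConn_single]
  simp

/-- The local metric, with its Levi-Civita connection, given by components. -/
def coordMetric (hU : IsOpen U) (hG : ∀ a b, ContDiffOn ℝ ∞ (fun y => G y a b) U)
    (hs : ∀ y a b, G y a b = G y b a) (hdet : ∀ y ∈ U, (G y).det ≠ 0) : LocalMetric (Coord d) where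
  U := U
  isOpen := hU
  g := coordForm G
  Γ := coordConn G
  contDiffOn_g := contDiffOn_coordForm hG
  contDiffOn_Γ := contDiffOn_coordConn hU hG hdet
  g_symm := coordForm_symm hs
  Γ_symm := coordConn_symm hs
  compat := by
    intro y hy e u v
    refine IsLinearMap.ext_single (f := fun e => fderiv ℝ (coordForm G) y e u v)
      (g := fun e => coordForm G y (coordConn G y e u) v + coordForm G y u (coordConn G y e v))
      (by constructor <;> intros <;> simp) (by constructor <;> intros <;> simp <;> ring) ?_ e
    intro c
    refine IsLinearMap.ext_single (f := fun u => fderiv ℝ (coordForm G) y _ u v)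
      (g := fun u => coordForm G y (coordConn G y _ u) v + coordForm G y u (coordConn G y _ v))
      (by constructor <;> intros <;> simp) (by constructor <;> intros <;> simp <;> ring) ?_ u
    intro a
    refine IsLinearMap.ext_single (f := fun v => fderiv ℝ (coordForm G) y _ _ v)
      (g := fun v => coordForm G y (coordConn G y _ _) v + coordForm G y _ (coordConn G y _ v))
      (by constructor <;> intros <;> simp) (by constructor <;> intros <;> simp <;> ring) ?_ v
    intro b
    rw [fderiv_coordForm hU hG hy, coordForm_symm hs, coordForm_coordConn_single (hdet y hy),
      coordForm_coordConn_single (hdet y hy)]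
    simp only [hs _ b a, hs _ c a, hs _ c b]
    ring

variable (hU : IsOpen U) (hG : ∀ a b, ContDiffOn ℝ ∞ (fun y => G y a b) U)
    (hs : ∀ y a b, G y a b = G y b a) (hdet : ∀ y ∈ U, (G y).det ≠ 0)

lemma coordMetric_curv_single {y : Coord d} (hy : y ∈ U) (a b c f : Fin d) :
    (coordMetric hU hG hs hdet).curv y (EuclideanSpace.single c 1) (EuclideanSpace.single f 1)
      (EuclideanSpace.single b 1) a = riemannUp G a b c f y := by
  have h2 : ∀ b c (v : Coord d), coordConn G y (EuclideanSpace.single c 1) v b =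
      ∑ e, christoffel G b c e y * v e := by
    intro b c v
    rw [coordConn_apply]
    simp
  simp only [LocalMetric.curv, coordMetric, PiLp.sub_apply, PiLp.add_apply,
    fderiv_coordConn hU hG hdet hy, h2, riemannUp, Finset.sum_sub_distrib]
  simp
  ring

lemma coordMetric_riem_single {y : Coord d} (hy : y ∈ U) (a b c f : Fin d) :
    (coordMetric hU hG hs hdet).riem y (EuclideanSpace.single a 1) (EuclideanSpace.single b 1)
      (EuclideanSpace.single c 1) (EuclideanSpace.single f 1) = riemannDown G a b c f y := by
  have h : ∀ w, (coordMetric hU hG hs hdet).g y (EuclideanSpace.single a 1) w =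
      ∑ e, G y a e * w e := by
    intro w
    change coordForm G y _ w = _
    rw [coordForm_apply]
    simp
  rw [LocalMetric.riem, h, riemannDown]
  simp only [coordMetric_curv_single hU hG hs hdet hy]

/-- The Ricci tensor as a trace. -/
lemma sum_curv_eq {y : Coord d} (hy : y ∈ U) (u v : Coord d) :
    ∑ a, (coordMetric hU hG hs hdet).curv y (EuclideanSpace.single a 1) v u a =
      ∑ b, ∑ f, ricciComp G b f y * u b * v f := by
  set S := coordMetric hU hG hs hdet
  have h1 : ∀ a, S.curv y (EuclideanSpace.single a 1) v u a =
      ∑ b, ∑ f, riemannUp G a b a f y * u b * v f := by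
    intro a
    have e1 := congrArg (fun w : Coord d => w a) (IsLinearMap.apply_eq_sum
      (LocalMetric.isLinearMap_curv₃ (S := S) y (EuclideanSpace.single a 1) v) u)
    simp only at e1
    rw [e1]
    simp only [WithLp.ofLp_sum, Finset.sum_apply, PiLp.smul_apply, smul_eq_mul]
    refine Finset.sum_congr rfl fun b _ => ?_
    have e2 := congrArg (fun w : Coord d => w a) (IsLinearMap.apply_eq_sum
      (LocalMetric.isLinearMap_curv₂ (S := S) y (EuclideanSpace.single a 1)
        (EuclideanSpace.single b 1)) v)
    simp only at e2
    rw [e2]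
    simp only [WithLp.ofLp_sum, Finset.sum_apply, PiLp.smul_apply, smul_eq_mul, Finset.mul_sum]
    refine Finset.sum_congr rfl fun f _ => ?_
    rw [coordMetric_curv_single hU hG hs hdet hy]; ring
  simp only [h1, ricciComp, Finset.sum_mul]
  rw [Finset.sum_comm]
  refine Finset.sum_congr rfl fun b _ => ?_
  rw [Finset.sum_comm]

lemma coordMetric_nabla (V : Coord d → Coord d) {y : Coord d}
    (hV : DifferentiableAt ℝ V y) (v : Coord d) (a : Fin d) :
    (coordMetric hU hG hs hdet).nabla V y v a =
      ∑ b, covDerivComp G (fun z c => V z c) a b y * v b := by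
  set S := coordMetric hU hG hs hdet
  have hlin : IsLinearMap ℝ (fun v => S.nabla V y v) := by
    constructor <;> intros <;> simp [LocalMetric.nabla] ; abel
  have e1 := congrArg (fun w : Coord d => w a) (IsLinearMap.apply_eq_sum hlin v)
  simp only at e1
  rw [e1]
  simp only [WithLp.ofLp_sum, Finset.sum_apply, PiLp.smul_apply, smul_eq_mul]
  refine Finset.sum_congr rfl fun b _ => ?_
  rw [mul_comm, covDerivComp, LocalMetric.nabla, PiLp.add_apply]
  congr 2
  · have h3 := (EuclideanSpace.proj a : Coord d →L[ℝ] ℝ).hasFDerivAt.comp y hV.hasFDerivAt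
    have h4 : ⇑(EuclideanSpace.proj a : Coord d →L[ℝ] ℝ) ∘ V = fun z => V z a := by
      funext z; simp
    rw [h4] at h3
    rw [partialDeriv, h3.fderiv]
    simp
  · change coordConn G y _ _ a = _
    rw [coordConn_apply]
    simp

end CoordinateMetric

namespace RadiationField

variable {E : Type*} [NormedAddCommGroup E] [NormedSpace ℝ E] {N : ℕ} {S : RadiationField E} {y : E}

lemma isLinearMap_weylT₂ (hy : y ∈ S.U) (a c f : E) :
    IsLinearMap ℝ (fun b => S.weylT N y a b c f) := by
  simp only [weylT_antisymm_left hy a]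
  exact (-(isLinearMap_weylT (S := S) (N := N) (y := y) a c f).mk' _).isLinear

lemma isLinearMap_weylT₃ (hy : y ∈ S.U) (a b f : E) :
    IsLinearMap ℝ (fun c => S.weylT N y a b c f) := by
  simp only [weylT_pair hy a b]
  exact isLinearMap_weylT f a b

lemma isLinearMap_weylT₄ (hy : y ∈ S.U) (a b c : E) :
    IsLinearMap ℝ (fun f => S.weylT N y a b c f) := by
  simp only [weylT_pair hy a b]
  exact isLinearMap_weylT₂ hy c a b

end RadiationField

section CoordinateRadiation

variable {d : ℕ} {U : Set (Coord d)} {G : Coord d → Matrix (Fin d) (Fin d) ℝ}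

/-- The matrix of a form admitting a null frame is invertible. -/
lemma det_ne_zero_of_isNullTetrad {N : ℕ} (hd : d = N + 2) (hs : ∀ y a b, G y a b = G y b a)
    {y l n : Coord d} {m : Fin N → Coord d} (ht : IsNullTetrad (coordForm G y) l n m) :
    (G y).det ≠ 0 := by
  intro h0
  obtain ⟨v, hv, hGv⟩ := Matrix.exists_mulVec_eq_zero_iff.2 h0
  have h1 : ∀ u, coordForm G y (WithLp.toLp 2 v) u = 0 := by
    intro u
    rw [coordForm_symm hs, coordForm_apply]
    refine Finset.sum_eq_zero fun a _ => ?_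
    have := congrFun hGv a
    simp only [Matrix.mulVec, dotProduct, Pi.zero_apply] at this
    calc _ = u a * ∑ b, G y a b * v b := by
          rw [Finset.mul_sum]; exact Finset.sum_congr rfl fun b _ => by ring
      _ = 0 := by rw [this, mul_zero]
  have h2 := ht.expand (by simp [hd]) (coordForm_symm hs y) (WithLp.toLp 2 v)
  simp only [h1, zero_smul, Finset.sum_const_zero, add_zero] at h2
  apply hv
  have := congrArg (WithLp.ofLp) h2
  simpa using this

/-- The trace of a linear map in a null frame. -/
lemma sum_apply_single_eq {N : ℕ} (hd : d = N + 2) (hs : ∀ y a b, G y a b = G y b a)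
    {y l n : Coord d} {m : Fin N → Coord d} (ht : IsNullTetrad (coordForm G y) l n m)
    {A : Coord d → Coord d} (hA : IsLinearMap ℝ A) :
    ∑ a, A (EuclideanSpace.single a 1) a = coordForm G y n (A l) + coordForm G y l (A n)
      + ∑ i, coordForm G y (m i) (A (m i)) := by
  have h1 : ∀ w v : Coord d, coordForm G y w v =
      ∑ a, v a * coordForm G y (EuclideanSpace.single a 1) w := by
    intro w v
    rw [coordForm_symm hs]
    have := IsLinearMap.apply_eq_sum (f := fun v => coordForm G y v w)
      ⟨fun a b => by simp, fun c a => by simp⟩ v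
    simpa using this
  have h2 : ∀ a, A (EuclideanSpace.single a 1) a =
      coordForm G y (EuclideanSpace.single a 1) n * A l a
      + coordForm G y (EuclideanSpace.single a 1) l * A n a
      + ∑ i, coordForm G y (EuclideanSpace.single a 1) (m i) * A (m i) a := by
    intro a
    have := congrArg (fun w : Coord d => w a)
      (ht.apply_eq (by simp [hd]) (coordForm_symm hs y) hA (EuclideanSpace.single a 1))
    simpa using this
  simp only [h2, Finset.sum_add_distrib]
  rw [Finset.sum_comm, h1 n, h1 l]
  simp only [h1 (m _)]
  simp only [mul_comm]

variable (hU : IsOpen U) (hG : ∀ a b, ContDiffOn ℝ ∞ (fun y => G y a b) U)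
    (hs : ∀ y a b, G y a b = G y b a) (hdet : ∀ y ∈ U, (G y).det ≠ 0)
    {l k : Coord d → Coord d} {η : Coord d → ℝ} (lam : ℝ) (hl : ContDiffOn ℝ ∞ l U)
    (hk : ContDiffOn ℝ ∞ k U) (hη : ContDiffOn ℝ ∞ η U)

/-- The local data of a metric given by components. -/
def coordRadiation : RadiationField (Coord d) where
  toLocalMetric := coordMetric hU hG hs hdet
  l := l
  k := k
  η := η
  lam := lam
  contDiffOn_l := hl
  contDiffOn_k := hk
  contDiffOn_η := hη

variable {lam} {y : Coord d}

lemma scalarCurv_eq (hs : ∀ y a b, G y a b = G y b a) (hdet : (G y).det ≠ 0) {k : Coord d} {η : ℝ}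
    (hnull : coordForm G y k k = 0) (hric : ∀ a b, ricciComp G a b y = lam * G y a b
      + η * (coordForm G y k (EuclideanSpace.single a 1)
        * coordForm G y k (EuclideanSpace.single b 1))) :
    scalarCurv G y = lam * d := by
  have hi : (G y)⁻¹ * G y = 1 := Matrix.nonsing_inv_mul _ (isUnit_iff_ne_zero.2 hdet)
  have h1 : ∀ b, coordForm G y k (EuclideanSpace.single b 1) = ∑ c, G y b c * k c := by
    intro b
    rw [coordForm_symm hs, coordForm_apply]
    simp
  have h2 : ∀ a, ∑ b, (G y)⁻¹ a b * coordForm G y k (EuclideanSpace.single b 1) = k a := by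
    intro a
    have := congrFun (congrArg (fun A => A.mulVec (WithLp.ofLp k)) hi) a
    simp only [Matrix.one_mulVec] at this
    rw [← this, ← Matrix.mulVec_mulVec]
    simp only [Matrix.mulVec, dotProduct, h1]
  have h3 : ∑ a, ∑ b, (G y)⁻¹ a b * G y a b = d := by
    have : ∀ a, ∑ b, (G y)⁻¹ a b * G y a b = 1 := fun a => by
      have h4 := congrFun (congrFun hi a) a
      rw [Matrix.mul_apply, Matrix.one_apply_eq] at h4
      simpa only [hs y _ a] using h4
    simp [this]
  have h4 : ∑ a, k a * coordForm G y k (EuclideanSpace.single a 1) = 0 := by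
    rw [← hnull]
    have := IsLinearMap.apply_eq_sum (f := fun v => coordForm G y k v)
      ⟨fun a b => by simp, fun c a => by simp⟩ k
    simpa using this.symm
  calc scalarCurv G y = lam * ∑ a, ∑ b, (G y)⁻¹ a b * G y a b
        + η * ∑ a, (∑ b, (G y)⁻¹ a b * coordForm G y k (EuclideanSpace.single b 1))
          * coordForm G y k (EuclideanSpace.single a 1) := by
        simp only [scalarCurv, hric, Finset.mul_sum, Finset.sum_mul, ← Finset.sum_add_distrib]
        refine Finset.sum_congr rfl fun a _ => Finset.sum_congr rfl fun b _ => ?_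
        ring
    _ = lam * d := by rw [h3]; simp only [h2]; rw [h4]; ring

lemma weylT_single {N : ℕ} (hN : 0 < N) (hd : d = N + 2) (hy : y ∈ U)
    (hnull : coordForm G y (k y) (k y) = 0) (hric : ∀ a b, ricciComp G a b y = lam * G y a b
      + η y * (coordForm G y (k y) (EuclideanSpace.single a 1)
        * coordForm G y (k y) (EuclideanSpace.single b 1))) (a b c f : Fin d) :
    (coordRadiation hU hG hs hdet lam hl hk hη).weylT N y (EuclideanSpace.single a 1)
      (EuclideanSpace.single b 1) (EuclideanSpace.single c 1) (EuclideanSpace.single f 1)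
      = weylComp G a b c f y := by
  have hg : ∀ a b, (coordRadiation hU hG hs hdet lam hl hk hη).g y (EuclideanSpace.single a 1)
      (EuclideanSpace.single b 1) = G y a b := fun a b => coordForm_single G y a b
  have hr : (coordRadiation hU hG hs hdet lam hl hk hη).riem y (EuclideanSpace.single a 1)
      (EuclideanSpace.single b 1) (EuclideanSpace.single c 1) (EuclideanSpace.single f 1)
      = riemannDown G a b c f y := coordMetric_riem_single hU hG hs hdet hy a b c f
  have hp : ∀ a b, (coordRadiation hU hG hs hdet lam hl hk hη).phi y (EuclideanSpace.single a 1)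
      (EuclideanSpace.single b 1) = ricciComp G a b y - lam * G y a b := fun a b => by
    rw [hric]
    simp only [RadiationField.phi]
    change η y * (coordForm G y (k y) _ * coordForm G y (k y) _) = _
    ring
  have hd1 : (d : ℝ) - 2 = N := by rw [hd]; push_cast; ring
  have hd2 : (d : ℝ) - 1 = N + 1 := by rw [hd]; push_cast; ring
  have hN' : (N : ℝ) ≠ 0 := by positivity
  have hN'' : (N : ℝ) + 1 ≠ 0 := by positivity
  rw [RadiationField.weylT, weylComp, hr, scalarCurv_eq hs (hdet y hy) hnull hric]
  simp only [hg, hp, hd1, hd2]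
  change _ - _ - lam / (N + 1) * _ = _
  rw [show (d : ℝ) = N + 2 by linarith, hs y c b, hs y c a, hs y f a, hs y f b]
  field_simp
  ring

end CoordinateRadiation

namespace IsNullTetrad

variable {E : Type*} [NormedAddCommGroup E] [NormedSpace ℝ E] [FiniteDimensional ℝ E] {N : ℕ}
  {B : E →L[ℝ] E →L[ℝ] ℝ} {l n : E} {m : Fin N → E}

lemma eq_zero (hE : Module.finrank ℝ E = N + 2) (hB : ∀ u v, B u v = B v u)
    (h : IsNullTetrad B l n m) {f : E → ℝ} (hf : IsLinearMap ℝ f) (hl : f l = 0) (hn : f n = 0)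
    (hm : ∀ i, f (m i) = 0) (u : E) : f u = 0 := by
  rw [h.apply_eq hE hB hf u]
  simp [hl, hn, hm]

lemma eq_zero_of_perp (hE : Module.finrank ℝ E = N + 2) (hB : ∀ u v, B u v = B v u)
    (h : IsNullTetrad B l n m) {f : E → ℝ} (hf : IsLinearMap ℝ f) (hl : f l = 0)
    (hm : ∀ i, f (m i) = 0) {u : E} (hu : B l u = 0) : f u = 0 := by
  rw [h.apply_eq hE hB hf u]
  simp [hl, hm, hB u l, hu]

end IsNullTetrad

lemma IsNullTetrad.spin {E : Type*} [NormedAddCommGroup E] [NormedSpace ℝ E] {N : ℕ}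
    {B : E →L[ℝ] E →L[ℝ] ℝ} {l n : E} {m : Fin N → E} (h : IsNullTetrad B l n m)
    {X : Matrix (Fin N) (Fin N) ℝ} (hX : X * X.transpose = 1) :
    IsNullTetrad B l n (fun i => ∑ j, X i j • m j) where
  l_l := h.l_l
  n_n := h.n_n
  l_m i := by simp [h.l_m]
  n_m i := by simp [h.n_m]
  l_n := h.l_n
  m_m i j := by
    have h1 := congrFun (congrFun hX i) j
    rw [Matrix.mul_apply, Matrix.one_apply] at h1
    rw [← h1]
    simp [h.m_m, Matrix.transpose_apply, mul_comm]

/-- The optical matrix in a frame. -/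
def RadiationField.rho {E : Type*} [NormedAddCommGroup E] [NormedSpace ℝ E] {N : ℕ}
    (S : RadiationField E) (y : E) (m : Fin N → E) : Matrix (Fin N) (Fin N) ℝ :=
  fun i j => S.g y (m i) (S.nabla S.l y (m j))

lemma RadiationField.rho_spin {E : Type*} [NormedAddCommGroup E] [NormedSpace ℝ E] {N : ℕ}
    (S : RadiationField E) (y : E) (m : Fin N → E) (X : Matrix (Fin N) (Fin N) ℝ) :
    S.rho y (fun i => ∑ j, X i j • m j) = X * S.rho y m * X.transpose := by
  have hlin : IsLinearMap ℝ (fun v => S.nabla S.l y v) := by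
    constructor <;> intros <;> simp [LocalMetric.nabla]; abel
  ext i j
  have h1 : S.nabla S.l y (∑ b, X j b • m b) = ∑ b, X j b • S.nabla S.l y (m b) := by
    have := map_sum (hlin.mk' _) (fun b => X j b • m b) Finset.univ
    simpa only [IsLinearMap.mk'_apply, hlin.map_smul] using this
  simp only [rho, h1, Matrix.mul_apply, Matrix.transpose_apply, map_sum, map_smul, Finset.sum_mul,
    Finset.mul_sum, smul_eq_mul, _root_.sum_apply, smul_apply]
  refine Finset.sum_congr rfl fun a _ => Finset.sum_congr rfl fun b _ => ?_
  ring

namespace RadiationField.IsTypeN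

open Matrix

variable {E : Type*} [NormedAddCommGroup E] [NormedSpace ℝ E] [FiniteDimensional ℝ E] {N : ℕ}
  {S : RadiationField E} {y n n' : E} {m m' : Fin N → E}

/-- For a geodetic field, absence of twist does not depend on the null frame. -/
lemma rho_symm (h : S.IsTypeN N) (hy : y ∈ S.U) (ht : IsNullTetrad (S.g y) (S.l y) n m)
    (ht' : IsNullTetrad (S.g y) (S.l y) n' m')
    (hs : ∀ i j, S.g y (m' i) (S.nabla S.l y (m' j)) = S.g y (m' j) (S.nabla S.l y (m' i)))
    (i j : Fin N) :
    S.g y (m i) (S.nabla S.l y (m j)) = S.g y (m j) (S.nabla S.l y (m i)) := by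
  have hlin : ∀ v, IsLinearMap ℝ (fun u => S.g y u (S.nabla S.l y v)
      - S.g y v (S.nabla S.l y u)) := fun v => by
    constructor <;> intros <;> simp [LocalMetric.nabla] <;> ring
  have hgeo : ∀ u, S.g y (S.l y) u = 0 → S.g y u (S.nabla S.l y (S.l y)) = 0 := fun u hu =>
    ht'.eq_zero_of_perp h.finrank (S.g_symm y) (f := fun u => S.g y u (S.nabla S.l y (S.l y)))
      ⟨fun a b => by simp, fun c a => by simp⟩ (h.nabla_l_perp hy _)
      (fun i => by rw [S.g_symm]; exact h.geodetic hy ht' i) hu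
  have hl : ∀ v, S.g y (S.l y) v = 0 → S.g y (S.l y) (S.nabla S.l y v)
      - S.g y v (S.nabla S.l y (S.l y)) = 0 := fun v hv => by
    rw [h.nabla_l_perp hy, hgeo v hv, sub_zero]
  have h1 : ∀ i u, S.g y (S.l y) u = 0 → S.g y u (S.nabla S.l y (m' i))
      - S.g y (m' i) (S.nabla S.l y u) = 0 := fun i u hu =>
    ht'.eq_zero_of_perp h.finrank (S.g_symm y) (hlin (m' i)) (hl _ (ht'.l_m i))
      (fun j => sub_eq_zero.2 (hs j i)) hu
  refine sub_eq_zero.1 (ht'.eq_zero_of_perp h.finrank (S.g_symm y) (hlin (m j)) (hl _ (ht.l_m j))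
    (fun k => ?_) (ht.l_m i))
  linarith [h1 k (m j) (ht.l_m j)]

/-- The canonical form of a symmetric optical matrix. -/
theorem exists_canonicalForm (h : S.IsTypeN N) (hy : y ∈ S.U)
    (ht : IsNullTetrad (S.g y) (S.l y) n m) (hsymm : (S.rho y m)ᵀ = S.rho y m) :
    ∃ X ∈ specialOrthogonalGroup (Fin N) ℝ, ∃ s b : ℝ,
      X * S.rho y m * Xᵀ = canonicalForm N s b ∧ (b = 1 ↔ S.η y = 0) ∧
      (s = 0 ↔ S.rho y m = 0) := by
  have hN := h.two_le
  have hN0 : (N : ℝ) ≠ 0 := by positivity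
  obtain ⟨X₀, r, hX₀, hr⟩ := exists_orthogonal_diagonal hsymm
  have hX₀' : X₀ᵀ * X₀ = 1 := mul_eq_one_comm.1 hX₀
  have ht₀ := ht.spin hX₀
  have hr₀ := hr
  rw [← rho_spin] at hr₀
  generalize (fun i => ∑ j, X₀ i j • m j) = m₀ at ht₀ hr₀
  have hL : ∀ i p, S.g y (S.nabla S.l y (m₀ i)) (m₀ p) = diagonal r i p := fun i p => by
    rw [S.g_symm]
    have := congrFun (congrFun hr₀ p) i
    rw [← diagonal_transpose, transpose_apply, ← this, rho]
  set φ := S.phi y n n with hφ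
  set Ω : Matrix (Fin N) (Fin N) ℝ := fun i j => S.weylT N y n (m₀ i) n (m₀ j) with hΩ
  set Q : Matrix (Fin N) (Fin N) ℝ := fun i j => Ω i j + if i = j then (N : ℝ)⁻¹ * φ else 0 with hQ
  have hΩs : ∀ i j, Ω i j = Ω j i := fun i j => weylT_pair hy _ _ _ _
  have htr : Q.trace = φ := by
    have h1 := h.weyl_trace y hy n m₀ ht₀
    have hQii : ∀ i, Q i i = Ω i i + (N : ℝ)⁻¹ * φ := fun i => by simp [hQ]
    change ∑ i, Q i i = φ
    simp only [hQii, Finset.sum_add_distrib]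
    rw [show ∑ i, Ω i i = 0 from h1]
    simp [hN0]
  have hQ0 : Q ≠ 0 := by
    intro h0
    have hφ0 : φ = 0 := by rw [← htr, h0, Matrix.trace_zero]
    obtain ⟨i, j, hne⟩ := h.exists_weyl_ne hy ht₀
    apply hne
    have := congrFun (congrFun h0 i) j
    simpa [hQ, hφ0] using this
  have hw : ∀ i j p q, diagonal r i p * Q q j - diagonal r i q * Q p j - diagonal r j p * Q q i
      + diagonal r j q * Q p i = 0 := by
    intro i j p q
    have := h.rho_wedge hy ht₀ i j p q
    simpa only [hL] using this
  have hcomm : ∀ i j, r i * Q i j = r j * Q i j := by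
    intro i j
    have h1 := h.rho_commute hy ht₀ (fun i j => by
      rw [hL, hL, ← diagonal_transpose, transpose_apply, diagonal_transpose]) i j
    simp only [hL, diagonal_apply, ite_mul, zero_mul, Finset.sum_ite_eq, Finset.mem_univ,
      if_true] at h1
    change r i * Ω i j = r j * Ω j i at h1
    rw [hΩs j i] at h1
    simp only [hQ]
    split_ifs with hij
    · rw [hij]
    · rw [add_zero, h1]
  rcases diagonal_wedge_eq_zero hN hQ0 hcomm hw with h0 | ⟨i, j, hij, hri, hk, hiff⟩
  · have hρ0 : S.rho y m = 0 := by
      have h1 : X₀ᵀ * (X₀ * S.rho y m * X₀ᵀ) * X₀ = S.rho y m := by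
        calc _ = (X₀ᵀ * X₀) * S.rho y m * (X₀ᵀ * X₀) := by simp only [Matrix.mul_assoc]
          _ = _ := by rw [hX₀', Matrix.one_mul, Matrix.mul_one]
      rw [← h1, hr, h0]
      simp
    classical
    refine ⟨1, one_mem _, 0, if S.η y = 0 then 1 else 0, ?_, ?_, by simp [hρ0]⟩
    · simp [hρ0, canonicalForm]
    · split_ifs with hη <;> simp [hη]
  · obtain ⟨σ, hσ0, hσ1⟩ := exists_perm_apply_eq hij
      (show (⟨0, by omega⟩ : Fin N) ≠ ⟨1, by omega⟩ by simp)
    obtain ⟨Y, hY, hYρ⟩ := exists_specialOrthogonal_diagonal (by omega) hX₀ hr σ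
    have hcan : diagonal (r ∘ σ) = canonicalForm N (r i) (r j / r i) := by
      rw [canonicalForm, ← diagonal_smul]
      congr 1
      funext a
      simp only [Function.comp_apply, Pi.smul_apply, smul_eq_mul]
      by_cases ha0 : (a : ℕ) = 0
      · rw [show a = ⟨0, by omega⟩ from Fin.ext ha0, hσ0]; simp
      by_cases ha1 : (a : ℕ) = 1
      · rw [show a = ⟨1, by omega⟩ from Fin.ext ha1, hσ1]; simp; field_simp
      · rw [if_neg ha0, if_neg ha1, mul_zero]
        refine hk _ (fun h1 => ha0 ?_) (fun h1 => ha1 ?_)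
        · rw [σ.injective (h1.trans hσ0.symm)]
        · rw [σ.injective (h1.trans hσ1.symm)]
    refine ⟨Y, hY, r i, r j / r i, by rw [hYρ, hcan], ?_, ?_⟩
    · rw [div_eq_one_iff_eq hri, hiff, htr, hφ, h.phi_n_n_eq_zero_iff hy ht₀]
    · refine ⟨fun h0 => absurd h0 hri, fun h0 => ?_⟩
      rw [h0, Matrix.mul_zero, Matrix.zero_mul] at hYρ
      have := congrFun (congrFun hYρ ⟨0, by omega⟩) ⟨0, by omega⟩
      simpa [hσ0] using this.symm

end RadiationField.IsTypeN

/-! ### Spacetimes in a chart -/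

section ChartCoordinates

variable {d : ℕ} {M : Type*} [TopologicalSpace M]
  [ChartedSpace (EuclideanSpace ℝ (Fin d)) M] [IsManifold (𝓡 d) ∞ M]
  {e : OpenPartialHomeomorph M (EuclideanSpace ℝ (Fin d))}

lemma mdifferentiable_chart_of_mem (he : e ∈ atlas (EuclideanSpace ℝ (Fin d)) M) :
    e.MDifferentiable (𝓡 d) (𝓡 d) := mdifferentiable_of_mem_atlas he

lemma contMDiffOn_coordVec (he : e ∈ atlas (EuclideanSpace ℝ (Fin d)) M)
    (v : EuclideanSpace ℝ (Fin d)) :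
    ContMDiffOn (𝓡 d) (𝓡 d).tangent ∞
      (fun y => (⟨e.symm y, mfderiv (𝓡 d) (𝓡 d) e.symm y v⟩ : TangentBundle (𝓡 d) M))
      e.target := by
  have h1 := contMDiffOn_symm_of_mem_maximalAtlas (I := 𝓡 d) (n := ∞)
    (IsManifold.subset_maximalAtlas he)
  have h2 := h1.contMDiffOn_tangentMapWithin (m := ∞) (by simp) e.open_target.uniqueMDiffOn
  have h3 : ContMDiffOn (𝓡 d) (𝓡 d).tangent ∞
      (fun y => (⟨y, v⟩ : TangentBundle (𝓡 d) (EuclideanSpace ℝ (Fin d)))) e.target := by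
    exact (contMDiffOn_vectorSpace_iff_contDiffOn (V := fun _ => v)).2 contDiffOn_const
  have h4 := h2.comp h3 (fun y hy => hy)
  refine h4.congr fun y hy => ?_
  simp only [tangentMapWithin, Function.comp_apply]
  rw [mfderivWithin_of_isOpen e.open_target hy]

lemma contDiffOn_metricComp (g : LorentzianMetric d M)
    (he : e ∈ atlas (EuclideanSpace ℝ (Fin d)) M) (a b : Fin d) :
    ContDiffOn ℝ ∞ (fun y => metricComp g e y a b) e.target := by
  rw [← contMDiffOn_iff_contDiffOn]
  have h1 := contMDiffOn_symm_of_mem_maximalAtlas (I := 𝓡 d) (n := ∞)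
    (IsManifold.subset_maximalAtlas he)
  have hg := g.contMDiff.comp_contMDiffOn h1
  have := ContMDiffOn.clm_bundle_apply₂ (F₁ := EuclideanSpace ℝ (Fin d))
    (F₂ := EuclideanSpace ℝ (Fin d)) (F₃ := ℝ) (E₃ := fun _ => ℝ) hg
    (contMDiffOn_coordVec he (EuclideanSpace.single a 1))
    (contMDiffOn_coordVec he (EuclideanSpace.single b 1))
  intro y hy
  exact (Bundle.contMDiffWithinAt_totalSpace.1 (this y hy)).2

lemma contDiffOn_field {X : VectorField d M} (hX : IsSmoothVectorField X)
    (he : e ∈ atlas (EuclideanSpace ℝ (Fin d)) M) :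
    ContDiffOn ℝ ∞ (fun y => (show EuclideanSpace ℝ (Fin d) from
      mfderiv (𝓡 d) (𝓡 d) e (e.symm y) (X (e.symm y)))) e.target := by
  have h1 := contMDiffOn_symm_of_mem_maximalAtlas (I := 𝓡 d) (n := ∞)
    (IsManifold.subset_maximalAtlas he)
  have h0 := contMDiffOn_of_mem_maximalAtlas (I := 𝓡 d) (n := ∞)
    (IsManifold.subset_maximalAtlas he)
  have h2 := h0.contMDiffOn_tangentMapWithin (m := ∞) (by simp) e.open_source.uniqueMDiffOn
  have h3 := hX.comp_contMDiffOn h1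
  have h4 := h2.comp h3 (fun y hy => e.map_target hy)
  have h5 := (contMDiff_snd_tangentBundle_modelSpace (EuclideanSpace ℝ (Fin d)) (𝓡 d)
    (n := ∞)).comp_contMDiffOn h4
  rw [contMDiffOn_iff_contDiffOn] at h5
  refine h5.congr fun y hy => ?_
  have h6 := mfderivWithin_of_isOpen (I := 𝓡 d) (I' := 𝓡 d) (f := e) e.open_source
    (e.map_target hy)
  exact congrArg (fun A => A (X (e.symm y))) h6.symm

/-- The coordinate representation of tangent vectors at `p`. -/
def toCoord (e : OpenPartialHomeomorph M (EuclideanSpace ℝ (Fin d))) (p : M) :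
    TangentSpace (𝓡 d) p →L[ℝ] Coord d :=
  mfderiv (𝓡 d) (𝓡 d) e p

/-- The tangent vector at the point with coordinates `y` with given components. -/
def fromCoord (e : OpenPartialHomeomorph M (EuclideanSpace ℝ (Fin d))) (y : Coord d) :
    Coord d →L[ℝ] TangentSpace (𝓡 d) (e.symm y) :=
  mfderiv (𝓡 d) (𝓡 d) e.symm y

lemma toCoord_fromCoord (he : e ∈ atlas (EuclideanSpace ℝ (Fin d)) M) {y : Coord d}
    (hy : y ∈ e.target) (v : Coord d) : toCoord e (e.symm y) (fromCoord e y v) = v :=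
  congrArg (fun A => A v) ((mdifferentiable_chart_of_mem he).comp_symm_deriv hy)

lemma toCoord_injective (he : e ∈ atlas (EuclideanSpace ℝ (Fin d)) M) {p : M}
    (hp : p ∈ e.source) : Function.Injective (toCoord e p) :=
  (mdifferentiable_chart_of_mem he).mfderiv_injective hp

lemma fromCoord_toCoord (he : e ∈ atlas (EuclideanSpace ℝ (Fin d)) M) {y : Coord d}
    (hy : y ∈ e.target) (u : TangentSpace (𝓡 d) (e.symm y)) :
    fromCoord e y (toCoord e (e.symm y) u) = u :=
  toCoord_injective he (e.map_target hy) (toCoord_fromCoord he hy _)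

lemma metricComp_symm (g : LorentzianMetric d M) (y : Coord d) (a b : Fin d) :
    metricComp g e y a b = metricComp g e y b a := g.symm _ _ _

lemma coordForm_metricComp (g : LorentzianMetric d M) (y v w : Coord d) :
    coordForm (metricComp g e) y v w = g.inner (e.symm y) (fromCoord e y v) (fromCoord e y w) := by
  have h1 : ∀ a, g.inner (e.symm y) (coordVec e y a) (fromCoord e y w) =
      ∑ b, w b * metricComp g e y a b := fun a => by
    have := IsLinearMap.apply_eq_sum
      (f := fun w => g.inner (e.symm y) (coordVec e y a) (fromCoord e y w))
      ⟨fun a b => by simp, fun c a => by simp⟩ w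
    exact this
  have h2 := IsLinearMap.apply_eq_sum
      (f := fun v => g.inner (e.symm y) (fromCoord e y v) (fromCoord e y w))
      ⟨fun a b => by simp, fun c a => by simp⟩ v
  simp only [smul_eq_mul] at h2
  rw [h2, coordForm_apply]
  refine Finset.sum_congr rfl fun a _ => ?_
  have h3 := h1 a
  change g.inner (e.symm y) (fromCoord e y (EuclideanSpace.single a 1)) (fromCoord e y w) = _ at h3
  rw [h3, Finset.mul_sum]
  exact Finset.sum_congr rfl fun b _ => by ring

lemma coordForm_toCoord (g : LorentzianMetric d M)
    (he : e ∈ atlas (EuclideanSpace ℝ (Fin d)) M) {y : Coord d} (hy : y ∈ e.target)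
    (u v : TangentSpace (𝓡 d) (e.symm y)) :
    coordForm (metricComp g e) y (toCoord e _ u) (toCoord e _ v) = g.inner (e.symm y) u v := by
  rw [coordForm_metricComp, fromCoord_toCoord he hy, fromCoord_toCoord he hy]

/-- The components of a vector field, as a vector field on the coordinate domain. -/
def coordField (e : OpenPartialHomeomorph M (EuclideanSpace ℝ (Fin d))) (X : VectorField d M)
    (y : Coord d) : Coord d :=
  toCoord e (e.symm y) (X (e.symm y))

lemma IsNullFrame.isNullTetrad {g : LorentzianMetric d M} {l : VectorField d M}
    (he : e ∈ atlas (EuclideanSpace ℝ (Fin d)) M) {y : Coord d} (hy : y ∈ e.target)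
    {F : Frame d (e.symm y)} (hF : IsNullFrame g l (e.symm y) F) :
    IsNullTetrad (coordForm (metricComp g e) y) (coordField e l y) (toCoord e _ F.n)
      (fun i => toCoord e _ (F.m i)) := by
  have hl : coordField e l y = toCoord e _ F.l := by rw [hF.l_eq]; rfl
  rw [hl]
  constructor <;> intros <;> rw [coordForm_toCoord g he hy]
  exacts [hF.l_l, hF.n_n, hF.l_m _, hF.n_m _, hF.l_n, hF.m_m _ _]

lemma det_metricComp_ne_zero (hd : 4 ≤ d) {g : LorentzianMetric d M} {l : VectorField d M}
    (he : e ∈ atlas (EuclideanSpace ℝ (Fin d)) M) (hN : IsWeylTypeN g l) :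
    ∀ y ∈ e.target, (metricComp g e y).det ≠ 0 := fun y hy => by
  obtain ⟨-, F, hF, -⟩ := hN e he (e.symm y) (e.map_target hy)
  exact det_ne_zero_of_isNullTetrad (by omega) (metricComp_symm g) (hF.isNullTetrad he hy)

/-- The local data of a spacetime in a chart. -/
def chartRadiation (hd : 4 ≤ d) {g : LorentzianMetric d M} {l k : VectorField d M} {η : M → ℝ}
    (lam : ℝ) (hl : IsSmoothVectorField l) (hk : IsSmoothVectorField k)
    (hη : ContMDiff (𝓡 d) 𝓘(ℝ, ℝ) ∞ η) (hN : IsWeylTypeN g l)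
    (he : e ∈ atlas (EuclideanSpace ℝ (Fin d)) M) : RadiationField (Coord d) :=
  coordRadiation (U := e.target) (G := metricComp g e) (l := coordField e l) (k := coordField e k)
    (η := fun y => η (e.symm y)) e.open_target
    (contDiffOn_metricComp g he) (metricComp_symm g)
    (det_metricComp_ne_zero hd he hN) lam (contDiffOn_field hl he) (contDiffOn_field hk he)
    (contMDiffOn_iff_contDiffOn.1 (hη.comp_contMDiffOn
      (contMDiffOn_symm_of_mem_maximalAtlas (I := 𝓡 d) (n := ∞)
        (IsManifold.subset_maximalAtlas he))))

end ChartCoordinates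

lemma neg_one_le_boostWeight {d : ℕ} (a : Fin 2 ⊕ Fin (d - 2)) : -1 ≤ boostWeight a := by
  rcases a with a | a
  · fin_cases a <;> simp [boostWeight]
  · simp [boostWeight]

lemma neg_two_lt_boostWeight_add {d : ℕ} {a b : Fin 2 ⊕ Fin (d - 2)} (h : a ≠ b) :
    -2 < boostWeight a + boostWeight b := by
  rcases a with a | a <;> rcases b with b | b
  · fin_cases a <;> fin_cases b <;> simp [boostWeight] at h ⊢
  · fin_cases a <;> simp [boostWeight]
  · fin_cases b <;> simp [boostWeight]
  · simp [boostWeight]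

/-- Ricci curvature along a null vector of a null frame. -/
lemma sum_riem_eq_ricciComp {d N : ℕ} {U : Set (Coord d)} {G : Coord d → Matrix (Fin d) (Fin d) ℝ}
    (hU : IsOpen U) (hG : ∀ a b, ContDiffOn ℝ ∞ (fun y => G y a b) U)
    (hs : ∀ y a b, G y a b = G y b a) (hdet : ∀ y ∈ U, (G y).det ≠ 0) (hd : d = N + 2)
    {y l n : Coord d} (hy : y ∈ U) {m : Fin N → Coord d}
    (ht : IsNullTetrad (coordForm G y) l n m) :
    ∑ i, (coordMetric hU hG hs hdet).riem y (m i) n (m i) n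
      + (coordMetric hU hG hs hdet).riem y n n l n
      = ∑ b, ∑ f, ricciComp G b f y * n b * n f := by
  rw [← sum_curv_eq hU hG hs hdet hy, sum_apply_single_eq hd hs ht
    (A := fun a => (coordMetric hU hG hs hdet).curv y a n n)
    (LocalMetric.isLinearMap_curv₁ (S := coordMetric hU hG hs hdet) y n n)]
  have h1 : coordForm G y l ((coordMetric hU hG hs hdet).curv y n n n) = 0 := by
    rw [show (coordMetric hU hG hs hdet).curv y n n n = 0 by simp [LocalMetric.curv], map_zero]
  rw [h1, add_zero, add_comm]
  rfl

variable {d : ℕ} {M : Type*} [TopologicalSpace M]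
  [ChartedSpace (EuclideanSpace ℝ (Fin d)) M] [IsManifold (𝓡 d) ∞ M]
  {e : OpenPartialHomeomorph M (EuclideanSpace ℝ (Fin d))} {g : LorentzianMetric d M}
  {l k : VectorField d M} {η : M → ℝ} {lam : ℝ} {y : Coord d}

lemma HasRicciForm.ricciComp_eq (hRic : HasRicciForm g lam η k)
    (he : e ∈ atlas (EuclideanSpace ℝ (Fin d)) M) (hy : y ∈ e.target) (a b : Fin d) :
    ricciComp (metricComp g e) a b y = lam * metricComp g e y a b + η (e.symm y) *
      (coordForm (metricComp g e) y (coordField e k y) (EuclideanSpace.single a 1)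
        * coordForm (metricComp g e) y (coordField e k y) (EuclideanSpace.single b 1)) := by
  have h1 := hRic e he (e.symm y) (e.map_target hy) (coordVec e y a) (coordVec e y b)
  have h2 : ∀ a, g.inner (e.symm y) (k (e.symm y)) (coordVec e y a) =
      coordForm (metricComp g e) y (coordField e k y) (EuclideanSpace.single a 1) := fun a => by
    rw [coordForm_metricComp, coordField, fromCoord_toCoord he hy]
    rfl
  have h3 : ∀ a c, vecComp e (e.symm y) (coordVec e y a) c =
      (EuclideanSpace.single a 1 : Coord d) c := fun a c =>
    congrArg (fun w : Coord d => w c) (toCoord_fromCoord he hy (EuclideanSpace.single a 1))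
  rw [h2, h2] at h1
  rw [show metricComp g e y a b = g.inner (e.symm y) (coordVec e y a) (coordVec e y b) from rfl,
    ← h1, ricci, e.right_inv hy]
  simp [h3]

section Chart

variable (hd : 4 ≤ d) (hl : IsSmoothVectorField l) (hk : IsSmoothVectorField k)
    (hη : ContMDiff (𝓡 d) 𝓘(ℝ, ℝ) ∞ η) (hN : IsWeylTypeN g l)
    (he : e ∈ atlas (EuclideanSpace ℝ (Fin d)) M)

lemma coordForm_coordField_null (he : e ∈ atlas (EuclideanSpace ℝ (Fin d)) M)
    (hknull : ∀ p, g.inner p (k p) (k p) = 0) (hy : y ∈ e.target) :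
    coordForm (metricComp g e) y (coordField e k y) (coordField e k y) = 0 := by
  rw [coordField, coordForm_toCoord g he hy, hknull]

lemma weyl_eq_weylT (hRic : HasRicciForm g lam η k) (hknull : ∀ p, g.inner p (k p) (k p) = 0)
    (hy : y ∈ e.target) (u v w x : TangentSpace (𝓡 d) (e.symm y)) :
    weyl g e (e.symm y) u v w x = (chartRadiation hd lam hl hk hη hN he).weylT (d - 2) y
      (toCoord e _ u) (toCoord e _ v) (toCoord e _ w) (toCoord e _ x) := by
  set S := chartRadiation hd lam hl hk hη hN he
  have hy' : y ∈ S.U := hy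
  have h0 : ∀ a b c f, S.weylT (d - 2) y (EuclideanSpace.single a 1)
      (EuclideanSpace.single b 1) (EuclideanSpace.single c 1) (EuclideanSpace.single f 1)
      = weylComp (metricComp g e) a b c f y := fun a b c f =>
    weylT_single _ _ _ _ _ _ _ (by omega) (by omega) hy
      (coordForm_coordField_null he hknull hy) (hRic.ricciComp_eq he hy) a b c f
  have h1 := IsLinearMap.apply_eq_sum (RadiationField.isLinearMap_weylT (S := S) (N := d - 2)
    (y := y) (toCoord e _ v) (toCoord e _ w) (toCoord e _ x)) (toCoord e _ u)
  have h2 := fun a => IsLinearMap.apply_eq_sum (RadiationField.isLinearMap_weylT₂ (N := d - 2)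
    hy' (EuclideanSpace.single a 1) (toCoord e _ w) (toCoord e _ x)) (toCoord e _ v)
  have h3 := fun a b => IsLinearMap.apply_eq_sum (RadiationField.isLinearMap_weylT₃ (N := d - 2)
    hy' (EuclideanSpace.single a 1) (EuclideanSpace.single b 1) (toCoord e _ x)) (toCoord e _ w)
  have h4 := fun a b c => IsLinearMap.apply_eq_sum (RadiationField.isLinearMap_weylT₄ (N := d - 2)
    hy' (EuclideanSpace.single a 1) (EuclideanSpace.single b 1) (EuclideanSpace.single c 1))
    (toCoord e _ x)
  simp only [smul_eq_mul] at h1 h2 h3 h4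
  rw [h1]
  simp only [h2, h3, h4, h0, Finset.mul_sum]
  rw [weyl, e.right_inv hy]
  refine Finset.sum_congr rfl fun a _ => Finset.sum_congr rfl fun b _ =>
    Finset.sum_congr rfl fun c _ => Finset.sum_congr rfl fun f _ => ?_
  change _ * toCoord e _ u a * toCoord e _ v b * toCoord e _ w c * toCoord e _ x f = _
  ring

lemma gradForm_eq (hy : y ∈ e.target) (u v : TangentSpace (𝓡 d) (e.symm y)) :
    gradForm g e l (e.symm y) u v = (chartRadiation hd lam hl hk hη hN he).g y (toCoord e _ u)
      ((chartRadiation hd lam hl hk hη hN he).nabla (coordField e l) y (toCoord e _ v)) := by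
  have hV : DifferentiableAt ℝ (coordField e l) y :=
    ((contDiffOn_field hl he).contDiffAt (e.open_target.mem_nhds hy)).differentiableAt (by simp)
  have h1 := coordMetric_nabla e.open_target (contDiffOn_metricComp g he) (metricComp_symm g)
    (det_metricComp_ne_zero hd he hN) (coordField e l) hV (toCoord e _ v)
  change _ = coordForm (metricComp g e) y (toCoord e _ u) ((coordMetric e.open_target
    (contDiffOn_metricComp g he) (metricComp_symm g) (det_metricComp_ne_zero hd he hN)).nabla
      (coordField e l) y (toCoord e _ v))
  rw [coordForm_apply, gradForm, e.right_inv hy]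
  simp only [h1, Finset.mul_sum]
  refine Finset.sum_congr rfl fun a _ => Finset.sum_congr rfl fun b _ =>
    Finset.sum_congr rfl fun c _ => ?_
  change _ * toCoord e _ u a * covDerivComp _ (fun z c => coordField e l z c) b c y
    * toCoord e _ v c = _
  ring

lemma sum_weylT_eq_zero (hRic : HasRicciForm g lam η k) (hy : y ∈ e.target) {n : Coord d}
    {m : Fin (d - 2) → Coord d}
    (ht : IsNullTetrad (coordForm (metricComp g e) y) (coordField e l y) n m) :
    ∑ i, (chartRadiation hd lam hl hk hη hN he).weylT (d - 2) y n (m i) n (m i) = 0 := by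
  set S := chartRadiation hd lam hl hk hη hN he
  have hy' : y ∈ S.U := hy
  have hN0 : ((d - 2 : ℕ) : ℝ) ≠ 0 := by
    have : d - 2 ≠ 0 := by omega
    exact_mod_cast this
  have h1 := sum_riem_eq_ricciComp e.open_target (contDiffOn_metricComp g he) (metricComp_symm g)
    (det_metricComp_ne_zero hd he hN) (by omega) hy ht
  change ∑ i, S.riem y (m i) n (m i) n + S.riem y n n (coordField e l y) n = _ at h1
  have h2 : ∑ b, ∑ f, ricciComp (metricComp g e) b f y * n b * n f = S.phi y n n := by
    have h3 : ∑ b, n b * coordForm (metricComp g e) y (coordField e k y)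
        (EuclideanSpace.single b 1) = coordForm (metricComp g e) y (coordField e k y) n :=
      (IsLinearMap.apply_eq_sum (f := fun v => coordForm (metricComp g e) y (coordField e k y) v)
        ⟨fun a b => by simp, fun c a => by simp⟩ n).symm
    have h4 := ht.n_n
    rw [coordForm_apply] at h4
    change _ = η (e.symm y) * (coordForm (metricComp g e) y (coordField e k y) n
      * coordForm (metricComp g e) y (coordField e k y) n)
    rw [← h3, Finset.sum_mul_sum]
    calc _ = lam * ∑ a, ∑ b, metricComp g e y a b * (n a * n b) + _ := ?_
      _ = _ := by rw [h4, mul_zero, zero_add]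
    simp only [hRic.ricciComp_eq he hy, Finset.mul_sum, ← Finset.sum_add_distrib]
    refine Finset.sum_congr rfl fun a _ => Finset.sum_congr rfl fun b _ => ?_
    ring
  have h5 : S.riem y n n (coordField e l y) n = 0 := by
    linarith [LocalMetric.riem_antisymm_left hy' n n (coordField e l y) n]
  have h6 : ∀ i, S.weylT (d - 2) y n (m i) n (m i) =
      S.riem y (m i) n (m i) n - ((d - 2 : ℕ) : ℝ)⁻¹ * S.phi y n n := fun i => by
    have e1 : S.g y n n = 0 := ht.n_n
    have e2 : S.g y n (m i) = 0 := ht.n_m i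
    have e3 : S.g y (m i) n = 0 := by rw [S.g_symm, e2]
    have e4 : S.g y (m i) (m i) = 1 := (ht.m_m i i).trans (if_pos rfl)
    rw [RadiationField.weylT, LocalMetric.riem_antisymm_left hy' n, LocalMetric.riem_antisymm_right,
      e1, e2, e3, e4]
    ring
  simp only [h6, Finset.sum_sub_distrib, Finset.sum_const, Finset.card_univ, Fintype.card_fin,
    nsmul_eq_mul]
  rw [h5, add_zero, h2] at h1
  rw [h1]
  field_simp
  ring

lemma isTypeN_chartRadiation (hRic : HasRicciForm g lam η k) (hk0 : ∀ p, k p ≠ 0)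
    (hknull : ∀ p, g.inner p (k p) (k p) = 0) :
    (chartRadiation hd lam hl hk hη hN he).IsTypeN (d - 2) := by
  set S := chartRadiation hd lam hl hk hη hN he with hS
  have hfin : Module.finrank ℝ (Coord d) = d - 2 + 2 := by simp; omega
  have hweyl : ∀ y ∈ S.U, (∀ b c f, S.weylT (d - 2) y (S.l y) b c f = 0) ∧
      ∀ a b c f, S.g y (S.l y) a = 0 → S.g y (S.l y) b = 0 → S.weylT (d - 2) y a b c f = 0 := by
    intro y hy
    obtain ⟨-, F, hF, hvan⟩ := hN e he (e.symm y) (e.map_target hy)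
    have ht : IsNullTetrad (S.g y) (S.l y) (toCoord e _ F.n) (fun i => toCoord e _ (F.m i)) :=
      hF.isNullTetrad he hy
    have hFl : toCoord e _ F.l = S.l y := by rw [hF.l_eq]; rfl
    have hT : ∀ a b c f : Fin 2 ⊕ Fin (d - 2),
        -2 < boostWeight a + boostWeight b + boostWeight c + boostWeight f →
        S.weylT (d - 2) y (toCoord e _ (F.vec a)) (toCoord e _ (F.vec b)) (toCoord e _ (F.vec c))
          (toCoord e _ (F.vec f)) = 0 := fun a b c f h => by
      rw [← weyl_eq_weylT hd hl hk hη hN he hRic hknull hy]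
      exact hvan a b c f h
    have hext : ∀ {f : Coord d → ℝ}, IsLinearMap ℝ f → (∀ a, f (toCoord e _ (F.vec a)) = 0) →
        ∀ u, f u = 0 := fun hf h u =>
      ht.eq_zero hfin (S.g_symm y) hf (hFl ▸ h (Sum.inl 0)) (h (Sum.inl 1))
        (fun i => h (Sum.inr i)) u
    have hself : ∀ a b c, S.weylT (d - 2) y a b c c = 0 := fun a b c => by
      linarith [RadiationField.weylT_antisymm_right (S := S) (N := d - 2) (y := y) a b c c]
    have hlast : ∀ a b : Fin 2 ⊕ Fin (d - 2), 0 ≤ boostWeight a + boostWeight b →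
        ∀ c f, S.weylT (d - 2) y (toCoord e _ (F.vec a)) (toCoord e _ (F.vec b)) c f = 0 := by
      intro a b hab c f
      refine hext (RadiationField.isLinearMap_weylT₃ hy _ _ _) (fun c => ?_) c
      refine hext (RadiationField.isLinearMap_weylT₄ hy _ _ _) (fun f => ?_) f
      by_cases hcf : c = f
      · rw [hcf, hself]
      · refine hT a b c f ?_
        have := neg_two_lt_boostWeight_add hcf
        omega
    have hl' : ∀ b c f, S.weylT (d - 2) y (S.l y) b c f = 0 := fun b c f => by
      refine hext (RadiationField.isLinearMap_weylT₂ hy _ _ _) (fun b => ?_) b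
      rw [← hFl]
      refine hlast (Sum.inl 0) b ?_ c f
      have := neg_one_le_boostWeight b
      change 0 ≤ 1 + boostWeight b
      omega
    refine ⟨hl', fun a b c f ha hb => ?_⟩
    refine ht.eq_zero_of_perp hfin (S.g_symm y) (RadiationField.isLinearMap_weylT b c f)
      (hl' b c f) (fun i => ?_) ha
    refine ht.eq_zero_of_perp hfin (S.g_symm y) (RadiationField.isLinearMap_weylT₂ hy _ c f)
      ?_ (fun j => ?_) hb
    · rw [RadiationField.weylT_antisymm_left hy, hl', neg_zero]
    · exact hlast (Sum.inr i) (Sum.inr j) (by simp [boostWeight]) c f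
  refine ⟨by omega, hfin, fun y hy => coordForm_coordField_null he hknull hy, fun y hy h0 => ?_,
    fun y hy => ?_, fun y hy => (hweyl y hy).1, fun y hy => (hweyl y hy).2,
    fun y hy n m ht => sum_weylT_eq_zero hd hl hk hη hN he hRic hy ht, fun y hy => ?_⟩
  · exact hk0 _ (toCoord_injective he (e.map_target hy)
      (h0.trans (map_zero (toCoord e (e.symm y))).symm))
  · obtain ⟨-, F, hF, -⟩ := hN e he (e.symm y) (e.map_target hy)
    exact ⟨_, _, hF.isNullTetrad he hy⟩
  · obtain ⟨⟨u, v, w, x, hne⟩, -⟩ := hN e he (e.symm y) (e.map_target hy)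
    rw [weyl_eq_weylT hd hl hk hη hN he hRic hknull hy] at hne
    exact ⟨_, _, _, _, hne⟩

end Chart

end Spacetime

end

theorem proposition3 {d : ℕ} (hd : 4 ≤ d) {M : Type*} [TopologicalSpace M]
    [ChartedSpace (EuclideanSpace ℝ (Fin d)) M] [IsManifold (𝓡 d) ∞ M]
    (g : Spacetime.LorentzianMetric d M)
    (l : Spacetime.VectorField d M) (hl : Spacetime.IsSmoothVectorField l)
    (lam : ℝ) (η : M → ℝ) (hη : ContMDiff (𝓡 d) 𝓘(ℝ, ℝ) ∞ η)
    (k : Spacetime.VectorField d M) (hk : Spacetime.IsSmoothVectorField k)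
    (hk0 : ∀ p, k p ≠ 0) (hknull : ∀ p, g.inner p (k p) (k p) = 0)
    (hN : Spacetime.IsWeylTypeN g l)
    (hRic : Spacetime.HasRicciForm g lam η k)
    (htf : Spacetime.IsTwistFree g l) :
    ∀ e ∈ atlas (EuclideanSpace ℝ (Fin d)) M, ∀ p ∈ e.source,
      ∀ F : Spacetime.Frame d p, Spacetime.IsNullFrame g l p F →
        Spacetime.IsGeodetic g e l p F ∧
        Spacetime.IsNormalMatrix (Spacetime.opticalMatrix g e l p F) ∧
        ∃ X ∈ Matrix.specialOrthogonalGroup (Fin (d - 2)) ℝ, ∃ s b : ℝ,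
          Spacetime.opticalMatrix g e l p (F.spin X) = Spacetime.canonicalForm (d - 2) s b ∧
          (b = 1 ↔ η p = 0) ∧
          (s = 0 ↔ Spacetime.IsKundt g e l p F) ∧
          (Spacetime.OpticalConstraint (Spacetime.opticalMatrix g e l p F) ↔
            s = 0 ∨ b = 0 ∨ b = 1) := by
  intro e he p hp F hF
  obtain ⟨y, hy, rfl⟩ : ∃ y ∈ e.target, e.symm y = p := ⟨e p, e.map_source hp, e.left_inv hp⟩
  have h := Spacetime.isTypeN_chartRadiation hd hl hk hη hN he hRic hk0 hknull
  have hgrad := Spacetime.gradForm_eq (lam := lam) hd hl hk hη hN he hy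
  set S := Spacetime.chartRadiation hd lam hl hk hη hN he
  have hyS : y ∈ S.U := hy
  have htet : ∀ F : Spacetime.Frame d (e.symm y), Spacetime.IsNullFrame g l (e.symm y) F →
      Spacetime.IsNullTetrad (S.g y) (S.l y) (Spacetime.toCoord e _ F.n)
        (fun i => Spacetime.toCoord e _ (F.m i)) := fun F hF => hF.isNullTetrad he hy
  have ht := htet F hF
  have hrho : ∀ F : Spacetime.Frame d (e.symm y), Spacetime.opticalMatrix g e l (e.symm y) F =
      S.rho y (fun i => Spacetime.toCoord e _ (F.m i)) := fun F => by
    ext i j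
    exact hgrad _ _
  have hgeo : Spacetime.IsGeodetic g e l (e.symm y) F := fun i => by
    rw [hgrad, S.g_symm, hF.l_eq]
    exact h.geodetic hyS ht i
  have hsymm : (S.rho y (fun i => Spacetime.toCoord e _ (F.m i))).transpose =
      S.rho y (fun i => Spacetime.toCoord e _ (F.m i)) := by
    obtain ⟨F', hF', hskew⟩ := htf e he _ hp
    ext i j
    refine h.rho_symm hyS ht (htet F' hF') (fun i j => ?_) j i
    have h1 := congrFun (congrFun hskew i) j
    rw [hrho] at h1
    simp only [Spacetime.skewPart, Matrix.smul_apply, Matrix.sub_apply, Matrix.transpose_apply,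
      Matrix.zero_apply, smul_eq_mul, Spacetime.RadiationField.rho] at h1
    linarith
  obtain ⟨X, hX, s, b, hcan, hb, hs⟩ := h.exists_canonicalForm hyS ht hsymm
  have hXX : X * X.transpose = 1 :=
    (Matrix.mem_orthogonalGroup_iff _ _).1 (Matrix.mem_specialOrthogonalGroup_iff.1 hX).1
  refine ⟨hgeo, ?_, X, hX, s, b, ?_, hb, ?_, ?_⟩
  · rw [Spacetime.IsNormalMatrix, hrho, hsymm]
  · rw [hrho, ← hcan, ← Spacetime.RadiationField.rho_spin]
    congr 1
    funext i
    simp [Spacetime.Frame.spin]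
  · rw [Spacetime.IsKundt, Spacetime.expansion_shear_twist_eq_zero_iff, hrho, hs]
    exact ⟨fun h0 => ⟨hgeo, h0⟩, fun h0 => h0.2⟩
  · rw [hrho, ← Spacetime.opticalConstraint_conj hXX, hcan,
      Spacetime.opticalConstraint_canonicalForm (by omega)]
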